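/- Let $R$ be a commutative noetherian ring with unit together with a surjective ring homomorphism $\Phi\colon R\to\mathbb Z/3$; put $I=\ker\Phi$ and $P=R/I$, a simple $R$-module with three elements. *Quasimodules.* A commutative Moufang loop is a loop $(Q,+,0)$ with $(x+x)+(a+b)=(x+a)+(x+b)$. A quasimodule is a commutative Moufang loop $Q$ with a map $R\times Q\to Q$ such that $r(x+y)=rx+ry$, $(r+s)x=rx+sx$, $(rs)x=r(sx)$, $1x=x$, $0x=0$ for all $r,s\in R$, $x,y\in Q$, and $rx+(y+z)=(rx+y)+z$ for all $r\in I$, $x,y,z\in Q$. It is hamiltonian if each of its subquasimodules is normal, i.e. is a block of a congruence of $Q$ (an equivalence relation compatible with $+$ and with scalars). It is non-associative if $(x+y)+z\ne x+(y+z)$ for some $x,y,z$. *Modules.* An $R$-module $M$ is cocyclic if its socle (the sum of all its minimal submodules) is simple and meets every non-zero submodule non-trivially. Let $K(M)=\{x\in M: Ix=0\}$; put $M_0=0$, $M_{\alpha+1}/M_\alpha=K(M/M_\alpha)$, $M_\alpha=\bigcup_{\beta<\alpha}M_\beta$ for limit ordinals $\alpha$, and $\widehat K(M)=\bigcup_\alpha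 M_\alpha$. The module $M$ is $\widehat K$-torsion if $\widehat K(M)=M$. Let $\mathrm{gen}(M)$ be the least number of generators of $M$. *The quasimodule $q(F_3)$.* Let $F_3=R^3\times P$, with canonical generators $a_1,a_2,a_3$ (the unit vectors of $R^3$) and $a_4=(0,1)$, and let $\tau\colon F_3^3\to F_3$ be the $R$-trilinear map with $\tau(a_1,a_2,a_3)=a_4$, $\tau(a_2,a_1,a_3)=-a_4$, and $\tau=0$ on all other triples of canonical generators. With $x*y=x+y+\tau(x,y,x-y)$ and the scalar multiplication of $F_3$, the set $F_3$ is a quasimodule $q(F_3)$. **Theorem.** (1) There exists a non-associative hamiltonian quasimodule if and only if there exists a finite cocyclic $\widehat K$-torsion $R$-module $M$ with $\mathrm{gen}(M)\ge 3$. (2) Let $M$ be a finite cocyclic $\widehat K$-torsion $R$-module with $\mathrm{gen}(M)\ge3$. There is an $R$-linear map $\pi\colon R^3\to M$ with $\mathrm{gen}(\pi(R^3))=3$. For every such $\pi$ there are a submodule $A$ of $R^3$ with $\ker\pi\subseteq A$ and a surjective $R$-linear map $\varphi\colon A\to P$ with kernel $\ker\pi$; and for each such pair $(A,\varphi)$,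 the set $V=\{(y,t)\in R^3\times P: y\in A,\ \varphi(y)=t\}$ is the preimage of $0$ under a surjective quasimodule homomorphism from $q(F_3)$ onto a non-associative hamiltonian quasimodule (so $q(F_3)/V$ is a non-associative hamiltonian quasimodule). -/

import Mathlib

/-! ### Quasimodules -/

/-- A commutative Moufang loop, written additively: a loop (a quasigroup with a neutral element)
satisfying `(x + x) + (a + b) = (x + a) + (x + b)`. Commutativity follows. -/
class CommMoufangLoop (Q : Type*) extends AddZeroClass Q where
  existsUnique_add_left : ∀ a b : Q, ∃! x : Q, a + x = b
  existsUnique_add_right : ∀ a b : Q, ∃! y : Q, y + a = b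
  moufang : ∀ x a b : Q, (x + x) + (a + b) = (x + a) + (x + b)

/-- A commutative Moufang loop `Q` with a scalar multiplication `R × Q → Q` is a quasimodule
(with respect to `Φ : R → ℤ/3`) if it satisfies the unitary module identities and if the
multiples `r • x` with `r ∈ ker Φ` are central. -/
class IsQuasimodule {R : Type*} [CommRing R] (Φ : R →+* ZMod 3) (Q : Type*)
    [CommMoufangLoop Q] [SMul R Q] : Prop where
  smul_add : ∀ (r : R) (x y : Q), r • (x + y) = r • x + r • y
  add_smul : ∀ (r s : R) (x : Q), (r + s) • x = r • x + s • x
  mul_smul : ∀ (r s : R) (x : Q), (r * s) • x = r • (s • x)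
  one_smul : ∀ x : Q, (1 : R) • x = x
  zero_smul : ∀ x : Q, (0 : R) • x = 0
  smul_add_assoc : ∀ r ∈ RingHom.ker Φ, ∀ x y z : Q, r • x + (y + z) = (r • x + y) + z

/-- The underlying loop of `Q` is associative; an associative quasimodule is just a module. -/
def IsAssociativeLoop (Q : Type*) [Add Q] : Prop :=
  ∀ x y z : Q, (x + y) + z = x + (y + z)

/-- A subquasimodule. Closedness under the two divisions of the loop is automatic, see
`Subquasimodule.mem_of_add_mem`, as `-x = (-1) • x`. -/
structure Subquasimodule (R : Type*) (Q : Type*) [AddZeroClass Q] [SMul R Q] where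
  carrier : Set Q
  zero_mem : (0 : Q) ∈ carrier
  add_mem : ∀ {x y : Q}, x ∈ carrier → y ∈ carrier → x + y ∈ carrier
  smul_mem : ∀ (r : R) {x : Q}, x ∈ carrier → r • x ∈ carrier

/-- A subquasimodule is normal if it is a block of a congruence of the quasimodule, that is,
of an equivalence relation compatible with the addition and the scalar multiplication. -/
def Subquasimodule.IsNormal {R Q : Type*} [AddZeroClass Q] [SMul R Q]
    (P : Subquasimodule R Q) : Prop :=
  ∃ c : ModuleCon R Q, P.carrier ∈ c.toSetoid.classes

/-- Every subquasimodule is normal. -/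
def IsHamiltonianQuasimodule (R : Type*) (Q : Type*) [AddZeroClass Q] [SMul R Q] : Prop :=
  ∀ P : Subquasimodule R Q, P.IsNormal

/-- A homomorphism of quasimodules. -/
structure IsQuasimoduleHom (R : Type*) {Q Q' : Type*} [Add Q] [SMul R Q] [Add Q'] [SMul R Q']
    (f : Q → Q') : Prop where
  map_add : ∀ x y : Q, f (x + y) = f x + f y
  map_smul : ∀ (r : R) (x : Q), f (r • x) = r • f x

namespace CommMoufangLoop

variable {Q : Type*} [CommMoufangLoop Q]

theorem add_left_inj' {a x y : Q} (h : a + x = a + y) : x = y :=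
  (existsUnique_add_left a (a + y)).unique h rfl

protected theorem comm (x y : Q) : x + y = y + x := by
  have h1 : ∀ x b : Q, (x + x) + b = x + (x + b) := fun x b => by
    simpa using moufang x 0 b
  have h2 : ∀ x a : Q, (x + x) + a = (x + a) + x := fun x a => by
    simpa using moufang x a 0
  obtain ⟨z, hz, -⟩ := existsUnique_add_left x y
  have h3 : x + (x + z) = (x + z) + x := (h1 x z).symm.trans (h2 x z)
  rwa [hz] at h3

end CommMoufangLoop

/-- `y = -x + (x + y)` in a quasimodule, hence subquasimodules are closed under division. -/
theorem Subquasimodule.mem_of_add_mem {R Q : Type*} [CommRing R] (Φ : R →+* ZMod 3)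
    [CommMoufangLoop Q] [SMul R Q] [IsQuasimodule Φ Q] (P : Subquasimodule R Q) {x y : Q}
    (hx : x ∈ P.carrier) (hxy : x + y ∈ P.carrier) : y ∈ P.carrier := by
  have h0 : x + (-1 : R) • x = 0 := by
    have h := IsQuasimodule.add_smul Φ (1 : R) (-1) x
    rw [IsQuasimodule.one_smul Φ, add_neg_cancel, IsQuasimodule.zero_smul Φ] at h
    exact h.symm
  have h1 : ∀ b : Q, (x + x) + b = x + (x + b) := fun b => by
    simpa using CommMoufangLoop.moufang x 0 b
  have h2 := CommMoufangLoop.moufang x ((-1 : R) • x) y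
  rw [h0, zero_add, h1] at h2
  have h3 : x + ((-1 : R) • x + y) = y := CommMoufangLoop.add_left_inj' h2
  have h4 : (-1 : R) • x + (x + y) = y := by
    have h5 := CommMoufangLoop.moufang ((-1 : R) • x) x y
    have h6 : ((-1 : R) • x + (-1 : R) • x) + (x + y)
        = (-1 : R) • x + ((-1 : R) • x + (x + y)) := by
      simpa using CommMoufangLoop.moufang ((-1 : R) • x) 0 (x + y)
    rw [h6, CommMoufangLoop.comm ((-1 : R) • x) x, h0, zero_add] at h5
    exact CommMoufangLoop.add_left_inj' h5
  rw [← h4]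
  exact P.add_mem (P.smul_mem _ hx) hxy

/-! ### Cocyclic modules and the radical of primitive torsion -/

section Modules

variable {R : Type*} [CommRing R]

/-- The socle: the submodule generated by all minimal submodules. -/
def moduleSocle (R : Type*) [CommRing R] (M : Type*) [AddCommGroup M] [Module R M] :
    Submodule R M :=
  sSup {N | IsAtom N}

/-- A module is cocyclic if its socle is a non-zero essential simple submodule. -/
structure IsCocyclicModule (R : Type*) [CommRing R] (M : Type*) [AddCommGroup M] [Module R M] :
    Prop where
  simple : IsSimpleModule R (moduleSocle R M)
  essential : ∀ N : Submodule R M, N ≠ ⊥ → moduleSocle R M ⊓ N ≠ ⊥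

/-- `K(M)`: the greatest primitive submodule of `M`, i.e. the greatest submodule
annihilated by `ker Φ`. -/
def primitivePart (Φ : R →+* ZMod 3) (M : Type*) [AddCommGroup M] [Module R M] :
    Submodule R M :=
  Submodule.torsionBySet R M (RingHom.ker Φ : Set R)

theorem primitivePart_isGreatest (Φ : R →+* ZMod 3) (M : Type*) [AddCommGroup M] [Module R M] :
    IsGreatest {N : Submodule R M | ∀ r ∈ RingHom.ker Φ, ∀ x ∈ N, r • x = 0}
      (primitivePart Φ M) := by
  constructor
  · intro r hr x hx
    exact (Submodule.mem_torsionBySet_iff _ _).1 hx ⟨r, hr⟩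
  · intro N hN x hx
    exact (Submodule.mem_torsionBySet_iff _ _).2 fun r => hN r.1 r.2 x hx

/-- The submodule `N'` containing `N` with `N' / N = K(M / N)`. -/
def primitiveStep (Φ : R →+* ZMod 3) {M : Type*} [AddCommGroup M] [Module R M]
    (N : Submodule R M) : Submodule R M :=
  (primitivePart Φ (M ⧸ N)).comap N.mkQ

/-- The radical generated by `K`: the union of the transfinite chain `N_0 = 0`,
`N_{α+1} / N_α = K(M / N_α)`, and `N_α = ⋃_{β<α} N_β` for limit ordinals `α`. -/
noncomputable def primitiveRadical.{w} (Φ : R →+* ZMod 3) (M : Type w) [AddCommGroup M]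
    [Module R M] : Submodule R M :=
  ⨆ α : Ordinal.{w}, transfiniteIterate (primitiveStep Φ) α (⊥ : Submodule R M)

/-- `M` is torsion for the radical generated by `K`. -/
def IsPrimitiveTorsion (Φ : R →+* ZMod 3) (M : Type*) [AddCommGroup M] [Module R M] : Prop :=
  primitiveRadical Φ M = ⊤

end Modules

/-! ### Ternary algebras and the quasimodules they define -/

/-- A ternary algebra structure on an `R`-module `A`. -/
structure TernaryAlgebra {R : Type*} [CommRing R] (Φ : R →+* ZMod 3) (A : Type*)
    [AddCommGroup A] [Module R A] where
  τ : A →ₗ[R] A →ₗ[R] A →ₗ[R] A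
  smul_τ : ∀ r ∈ RingHom.ker Φ, ∀ x y z : A, r • τ x y z = 0
  τ_self : ∀ x y : A, τ x x y = 0
  τ_τ_left : ∀ x y z u v : A, τ (τ x y z) u v = 0
  τ_τ_right : ∀ x y z u v : A, τ u v (τ x y z) = 0

namespace TernaryAlgebra

variable {R : Type*} [CommRing R] {Φ : R →+* ZMod 3} {A : Type*} [AddCommGroup A] [Module R A]

/-- The carrier of the quasimodule defined by a ternary algebra; it is the set `A`. -/
def Quasi (_T : TernaryAlgebra Φ A) : Type _ := A

variable (T : TernaryAlgebra Φ A)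

/-- The loop operation `x + y + τ(x, y, x - y)`. -/
def op (x y : A) : A := x + y + T.τ x y (x - y)

theorem τ_swap (x y z : A) : T.τ y x z = - T.τ x y z := by
  have h := T.τ_self (x + y) z
  simp only [map_add, LinearMap.add_apply, T.τ_self, zero_add, add_zero] at h
  exact eq_neg_of_add_eq_zero_left h

theorem τ_τ_mid (x y z u v : A) : T.τ u (T.τ x y z) v = 0 := by
  rw [T.τ_swap, T.τ_τ_left, neg_zero]

theorem three_τ (x y z : A) : (3 : ℤ) • T.τ x y z = 0 := by
  have h := T.smul_τ (3 : R) (by rw [RingHom.mem_ker, map_ofNat]; rfl) x y z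
  rw [← h, ← Int.cast_smul_eq_zsmul R]
  norm_num

theorem cube_smul_τ (r : R) (x y z : A) : (r * (r * r)) • T.τ x y z = r • T.τ x y z := by
  have h3 : ∀ a : ZMod 3, a * (a * a) - a = 0 := by decide
  have h := T.smul_τ (r * (r * r) - r) (by
    rw [RingHom.mem_ker, map_sub, map_mul, map_mul]; exact h3 _) x y z
  rw [sub_smul] at h
  exact sub_eq_zero.1 h

theorem zero_op (x : A) : T.op 0 x = x := by simp [op]

theorem op_zero (x : A) : T.op x 0 = x := by simp [op]

theorem op_comm (x y : A) : T.op x y = T.op y x := by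
  simp only [op, map_sub]
  rw [T.τ_swap x y y, T.τ_swap x y x]
  abel

theorem op_existsUnique (a b : A) : ∃! x : A, T.op a x = b := by
  refine ⟨b - a - T.τ a b (a - (b - a)), ?_, ?_⟩
  · simp only [op, map_sub, LinearMap.sub_apply, T.τ_self, T.τ_τ_right, T.τ_τ_mid]
    abel
  · intro y hy
    subst hy
    simp only [op, map_sub, map_add, LinearMap.sub_apply, LinearMap.add_apply, T.τ_self,
      T.τ_τ_right, T.τ_τ_mid]
    abel

theorem op_moufang (x a b : A) :
    T.op (T.op x x) (T.op a b) = T.op (T.op x a) (T.op x b) := by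
  have h1 := T.three_τ x a x
  have h3 := T.three_τ x b x
  have h5 := T.three_τ x a b
  have h6 := T.three_τ x b a
  simp only [op, map_sub, map_add, LinearMap.sub_apply, LinearMap.add_apply, T.τ_self,
    T.τ_τ_left, T.τ_τ_right, T.τ_τ_mid, T.τ_swap x a, map_zero, LinearMap.zero_apply]
  rw [← sub_eq_zero]
  refine Eq.trans ?_ (show (3 : ℤ) • T.τ x a x + (3 : ℤ) • T.τ x b x - (3 : ℤ) • T.τ x a b
    - (3 : ℤ) • T.τ x b a = 0 by rw [h1, h3, h5, h6]; simp)
  abel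

theorem op_smul (r : R) (x y : A) : r • T.op x y = T.op (r • x) (r • y) := by
  simp only [op, map_sub, map_smul, LinearMap.smul_apply, smul_add, smul_sub, smul_smul]
  simp only [T.cube_smul_τ]

theorem op_add_smul (r s : R) (x : A) : (r + s) • x = T.op (r • x) (s • x) := by
  simp [op, add_smul, T.τ_self]

theorem op_central {r : R} (hr : r ∈ RingHom.ker Φ) (x y z : A) :
    T.op (r • x) (T.op y z) = T.op (T.op (r • x) y) z := by
  have h := T.smul_τ r hr
  simp only [op, map_sub, map_add, map_smul, LinearMap.sub_apply, LinearMap.add_apply,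
    LinearMap.smul_apply, T.τ_τ_right, T.τ_τ_mid, h, smul_add, smul_sub,
    smul_zero, map_zero, LinearMap.zero_apply]
  abel

instance : CommMoufangLoop T.Quasi where
  add := T.op
  zero := (0 : A)
  zero_add := T.zero_op
  add_zero := T.op_zero
  existsUnique_add_left := T.op_existsUnique
  existsUnique_add_right a b := by
    have h := T.op_existsUnique a b
    simp only [T.op_comm a] at h
    exact h
  moufang := T.op_moufang

instance : SMul R T.Quasi := inferInstanceAs (SMul R A)

/-- The loop `A(*)` with the scalar multiplication of `A` is a quasimodule. -/
instance : IsQuasimodule Φ T.Quasi where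
  smul_add := T.op_smul
  add_smul := T.op_add_smul
  mul_smul := SemigroupAction.mul_smul (β := A)
  one_smul := MulAction.one_smul (β := A)
  zero_smul := fun x : A => zero_smul R x
  smul_add_assoc _ hr := T.op_central hr

end TernaryAlgebra

/-! ### The ternary algebra `F₃` -/

/-- The underlying module `R³ × P` of `F₃`, where `P = R / ker Φ`. Its canonical generators are
`a₁, a₂, a₃` (the unit vectors of `R³`) and `a₄ = (0, 1)`. -/
abbrev FreeTernaryCarrier {R : Type*} [CommRing R] (Φ : R →+* ZMod 3) : Type _ :=
  (Fin 3 → R) × (R ⧸ RingHom.ker Φ)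

/-- The ternary algebra `F₃`: its trilinear map is the one with
`τ(a₁, a₂, a₃) = a₄`, `τ(a₂, a₁, a₃) = 2 a₄ = -a₄`, and `0` on all other triples of canonical
generators. -/
def freeTernary {R : Type*} [CommRing R] (Φ : R →+* ZMod 3) :
    TernaryAlgebra Φ (FreeTernaryCarrier Φ) where
  τ := LinearMap.mk₂ R
    (fun x y => (x.1 0 * y.1 1 - x.1 1 * y.1 0) •
      (LinearMap.inr R (Fin 3 → R) (R ⧸ RingHom.ker Φ) ∘ₗ (RingHom.ker Φ).mkQ ∘ₗ
        LinearMap.proj 2 ∘ₗ LinearMap.fst R (Fin 3 → R) (R ⧸ RingHom.ker Φ)))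
    (fun x x' y => by rw [← add_smul]; congr 1; simp; ring)
    (fun r x y => by rw [smul_smul]; congr 1; simp; ring)
    (fun x y y' => by rw [← add_smul]; congr 1; simp; ring)
    (fun r x y => by rw [smul_smul]; congr 1; simp; ring)
  smul_τ r hr x y z := by
    have h : ∀ t : R ⧸ RingHom.ker Φ, r • t = 0 := fun t => by
      rw [Algebra.smul_def, Ideal.Quotient.algebraMap_eq, Ideal.Quotient.eq_zero_iff_mem.2 hr,
        zero_mul]
    exact Prod.ext (by simp) (h _)
  τ_self x y := by simp [mul_comm]
  τ_τ_left x y z u v := by simp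
  τ_τ_right x y z u v := by simp

/-- For a submodule `A` of `R³` and a linear map `φ : A → P`, the graph of `φ`, that is, the set
of all `(y, t) ∈ R³ × P` with `y ∈ A` and `φ y = t`. -/
def graphSet {R : Type*} [CommRing R] (Φ : R →+* ZMod 3) (A : Submodule R (Fin 3 → R))
    (φ : A →ₗ[R] R ⧸ RingHom.ker Φ) : Set (freeTernary Φ).Quasi :=
  {x : FreeTernaryCarrier Φ | ∃ h : x.1 ∈ A, φ ⟨x.1, h⟩ = x.2}

universe u v w

/-! ### Commutative Moufang loops with central associators -/

namespace CommMoufangLoop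

variable {Q : Type*} [CommMoufangLoop Q]

/-! In a hamiltonian quasimodule `Q` normality of cyclic subquasimodules puts the associator `a` of
`x, y, z` into both `R x` and `R y`, say `a = r x = s y`. If `r ∈ I`, then `a` is central; otherwise
`r x = s y` associates with `y, z`, hence so does `x`, and `a = 0`. So associators are central, and
the Moufang law makes them trilinear, alternating and killed by `I`. A non-zero associator therefore
gives a homomorphism `g` from `q(F₃)` to `Q` with `a₄` not in its kernel.

From `Q` to `M`: let `N` be a subquasimodule of `q(F₃)` containing `ker g` but not `a₄`. Normality
of `g(N)` puts associators of elements of `N` back into `N`, and the coordinates of `n ∈ N` are, up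
to sign, such associators; a coordinate outside `I` would produce `a₄`. Hence `N ⊆ I R³ × P`. Choose
a submodule `W ⊇ ker g` of `I R³ × P` maximal without `a₄`. Then `M = F₃ / W` has `a₄` in every
non-zero submodule, needs three generators because `W` vanishes modulo `I`, and is finite and
torsion by Artin–Rees.

From `M` to `Q`: with `gen(π(R³)) = 3`, the preimage of the socle lies in `I R³`, so the graph `V`
of `φ` lies in `I R³ × P` and `τ` descends to `F₃ / V`. As a module this is `π(R³)`, with the class
of `a₄` in every non-zero submodule. All values of `τ` are multiples of `a₄`, so a non-zero
subquasimodule contains them all; it is then a submodule, and its cosets form a congruence. Since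
`a₄ ∉ V`, associativity fails. -/

theorem add_self_add (x b : Q) : (x + x) + b = x + (x + b) := by
  simpa using moufang x 0 b

theorem neg_smul_add_cancel_left {R : Type*} [CommRing R] (Φ : R →+* ZMod 3) [SMul R Q]
    [IsQuasimodule Φ Q] (x y : Q) : (-1 : R) • x + (x + y) = y := by
  have h0 : x + (-1 : R) • x = 0 := by
    have h := IsQuasimodule.add_smul Φ (1 : R) (-1) x
    rw [IsQuasimodule.one_smul Φ, add_neg_cancel, IsQuasimodule.zero_smul Φ] at h
    exact h.symm
  have h2 := moufang x ((-1 : R) • x) y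
  rw [h0, zero_add, add_self_add] at h2
  have h3 : x + ((-1 : R) • x + y) = y := add_left_inj' h2
  have h5 := moufang ((-1 : R) • x) x y
  rw [add_self_add, CommMoufangLoop.comm ((-1 : R) • x) x, h0, zero_add] at h5
  exact add_left_inj' h5

/-- The centre of a commutative Moufang loop. -/
@[ext]
structure Center (Q : Type*) [CommMoufangLoop Q] where
  val : Q
  add_add_eq : ∀ x y : Q, val + (x + y) = (val + x) + y

namespace Center

instance : CoeOut (Center Q) Q := ⟨Center.val⟩

theorem add_assoc' (c : Center Q) (x y : Q) : ((c : Q) + x) + y = c + (x + y) :=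
  (c.add_add_eq x y).symm

theorem add_left_comm' (c : Center Q) (x y : Q) : x + ((c : Q) + y) = c + (x + y) := by
  rw [CommMoufangLoop.comm x, add_assoc', CommMoufangLoop.comm y]

theorem exists_neg (c : Center Q) : ∃ d : Center Q, (d : Q) + c = 0 := by
  obtain ⟨x, hx, -⟩ := existsUnique_add_left (c : Q) 0
  refine ⟨⟨x, fun y z => add_left_inj' (a := (c : Q)) ?_⟩, by rwa [CommMoufangLoop.comm]⟩
  rw [← add_assoc', hx, ← add_assoc', ← add_assoc', hx, zero_add, zero_add]

instance : Zero (Center Q) := ⟨⟨0, fun x y => by simp⟩⟩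

instance : Add (Center Q) :=
  ⟨fun c d => ⟨c + d, fun x y => by simp only [add_assoc']⟩⟩

noncomputable instance : Neg (Center Q) := ⟨fun c => c.exists_neg.choose⟩

@[simp] theorem coe_zero : ((0 : Center Q) : Q) = 0 := rfl

@[simp] theorem coe_add (c d : Center Q) : ((c + d : Center Q) : Q) = c + d := rfl

noncomputable instance : AddCommGroup (Center Q) where
  add_assoc a b c := Center.ext (by simp [add_assoc'])
  zero_add a := Center.ext (by simp)
  add_zero a := Center.ext (by simp)
  add_comm a b := Center.ext (CommMoufangLoop.comm _ _)
  neg_add_cancel a := Center.ext a.exists_neg.choose_spec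
  nsmul := nsmulRec
  zsmul := zsmulRec

theorem coe_add_coe_add (c d : Center Q) (x : Q) :
    (c : Q) + ((d : Q) + x) = ((c + d : Center Q) : Q) + x := by
  rw [coe_add, add_assoc']

theorem add_right_cancel' {c d : Center Q} {x : Q} (h : (c : Q) + x = d + x) : c = d := by
  rw [CommMoufangLoop.comm, CommMoufangLoop.comm (d : Q)] at h
  exact Center.ext (add_left_inj' h)

theorem eq_neg_add {c : Center Q} {x y : Q} (h : x = c + y) : y = ((-c : Center Q) : Q) + x := by
  rw [h, coe_add_coe_add, neg_add_cancel, coe_zero, zero_add]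

/-- The centre of a quasimodule is a module. -/
@[reducible]
def module {R : Type*} [CommRing R] (Φ : R →+* ZMod 3) [SMul R Q] [IsQuasimodule Φ Q] :
    Module R (Center Q) where
  -- Modulo `I` the scalar `r` is 0, 1 or 2, and multiples by elements of `I` are central, so `r •
  -- c` is a sum of at most three central elements.
  smul r c := ⟨r • (c : Q), by
    have h3 : ∀ a : ZMod 3, a = 0 ∨ a - 1 = 0 ∨ a - 1 - 1 = 0 := by decide
    have key : ∀ (s : R) (d : Center Q), s ∈ RingHom.ker Φ → ∃ e : Center Q, (e : Q) = s • (d : Q) :=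
      fun s d hs => ⟨⟨s • (d : Q), fun x y => IsQuasimodule.smul_add_assoc s hs _ _ _⟩, rfl⟩
    suffices ∃ e : Center Q, (e : Q) = r • (c : Q) by
      obtain ⟨e, he⟩ := this
      rw [← he]
      exact e.add_add_eq
    rcases h3 (Φ r) with h | h | h
    · exact key r c h
    · obtain ⟨e, he⟩ := key (r - 1) c (by rw [RingHom.mem_ker, map_sub, map_one, h])
      refine ⟨e + c, ?_⟩
      rw [coe_add, he]
      nth_rw 2 [← IsQuasimodule.one_smul Φ (c : Q)]
      rw [← IsQuasimodule.add_smul Φ, sub_add_cancel]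
    · obtain ⟨e, he⟩ := key (r - 1 - 1) c (by
        rw [RingHom.mem_ker, map_sub, map_sub, map_one, h])
      refine ⟨(e + c) + c, ?_⟩
      rw [coe_add, coe_add, he]
      nth_rw 2 3 [← IsQuasimodule.one_smul Φ (c : Q)]
      rw [← IsQuasimodule.add_smul Φ, sub_add_cancel, ← IsQuasimodule.add_smul Φ, sub_add_cancel]⟩
  one_smul c := Center.ext (IsQuasimodule.one_smul Φ _)
  mul_smul r s c := Center.ext (IsQuasimodule.mul_smul Φ _ _ _)
  smul_zero r := Center.ext (by
    have h := IsQuasimodule.mul_smul Φ r 0 (0 : Q)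
    rw [mul_zero, IsQuasimodule.zero_smul Φ] at h
    exact h.symm)
  smul_add r c d := Center.ext (IsQuasimodule.smul_add Φ _ _ _)
  add_smul r s c := Center.ext (IsQuasimodule.add_smul Φ _ _ _)
  zero_smul c := Center.ext (IsQuasimodule.zero_smul Φ _)

end Center

/-- `A` is the associator of a loop all of whose associators are central. -/
def IsCentralAssociator (A : Q → Q → Q → Center Q) : Prop :=
  ∀ x y z : Q, (x + y) + z = A x y z + (x + (y + z))

namespace IsCentralAssociator

variable {A : Q → Q → Q → Center Q} (hA : IsCentralAssociator A)

include hA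

theorem add_add_eq (x y z : Q) : x + (y + z) = ((-A x y z : Center Q) : Q) + ((x + y) + z) :=
  Center.eq_neg_add (hA x y z)

theorem eq_of_add_eq {x y z : Q} {c : Center Q} (h : (x + y) + z = c + (x + (y + z))) :
    A x y z = c :=
  Center.add_right_cancel' ((hA x y z).symm.trans h)

theorem zero_right (x y : Q) : A x y 0 = 0 := hA.eq_of_add_eq (by simp)

theorem swap_outer (x y z : Q) : A z y x = - A x y z := by
  refine hA.eq_of_add_eq ?_
  rw [CommMoufangLoop.comm z y, CommMoufangLoop.comm _ x, CommMoufangLoop.comm y x,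
    CommMoufangLoop.comm z, CommMoufangLoop.comm y z, CommMoufangLoop.comm z y]
  exact hA.add_add_eq x y z

/-- Three uses of the Moufang law evaluate `(x + x) + ((y + y) + (a + b))`. The left side depends
only on `a + b`, so the pairs `(a, b)` and `(a + b, 0)` produce the same associator term. -/
theorem add_right (x y a b : Q) : A x y (a + b) = A x y a + A x y b := by
  have h : ∀ a b : Q, (x + x) + ((y + y) + (a + b))
      = ((-A x y a + -A x y b : Center Q) : Q) + (((x + y) + (x + y)) + (a + b)) := by
    intro a b
    rw [moufang y, moufang x, hA.add_add_eq x y a, hA.add_add_eq x y b, moufang (x + y),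
      Center.add_assoc', Center.add_left_comm', Center.coe_add_coe_add]
  have h1 := (h a b).symm.trans (by simpa only [add_zero] using h (a + b) 0)
  have h2 := Center.add_right_cancel' h1
  rw [hA.zero_right, neg_zero, add_zero, ← neg_add] at h2
  exact (neg_injective h2).symm

theorem add_left (x y a b : Q) : A (a + b) y x = A a y x + A b y x := by
  rw [hA.swap_outer x, hA.add_right, hA.swap_outer x, hA.swap_outer x, neg_add]

theorem moufang' (x a b : Q) : A x a (x + b) = A a x b - A x a b := by
  have h := moufang x a b
  rw [add_self_add, hA x a (x + b), hA.add_add_eq a x b, CommMoufangLoop.comm a x, hA x a b,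
    Center.coe_add_coe_add, Center.add_left_comm', Center.coe_add_coe_add] at h
  have h2 : A x a (x + b) + (-A a x b + A x a b) = 0 :=
    (Center.add_right_cancel' (c := 0) (by simpa using h)).symm
  rw [← sub_eq_zero, ← h2]
  abel

theorem self_right (x a : Q) : A x a x = 0 := by
  have h := hA.moufang' x a 0
  rwa [hA.zero_right, hA.zero_right, add_zero, sub_zero] at h

/-- The Moufang law yields a doubling rather than a sign. Applied twice it gives `A = 4 A`, so `3 A
= 0`, and only then does doubling become negation. -/
theorem swap_left_eq (x a b : Q) : A a x b = A x a b + A x a b := by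
  have h := hA.moufang' x a b
  rw [hA.add_right, hA.self_right, zero_add] at h
  exact (sub_eq_iff_eq_add.1 h.symm)

theorem three (x y z : Q) : A x y z + A x y z + A x y z = 0 := by
  have h := hA.swap_left_eq x y z
  have h' := hA.swap_left_eq y x z
  rw [h] at h'
  have : A x y z + (A x y z + A x y z + A x y z) = A x y z + 0 := by
    rw [add_zero]
    nth_rw 5 [h']
    abel
  exact add_left_cancel this

theorem swap_left (x y z : Q) : A y x z = - A x y z := by
  rw [hA.swap_left_eq x y z]
  exact eq_neg_of_add_eq_zero_left (hA.three x y z)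

theorem swap_right (x y z : Q) : A x z y = - A x y z := by
  rw [hA.swap_outer y z x, hA.swap_left z y x, neg_neg, hA.swap_outer x y z]

theorem self_left (x y : Q) : A x x y = 0 := by
  rw [hA.swap_right x y x, hA.self_right, neg_zero]

theorem self_mid (x y : Q) : A y x x = 0 := by
  rw [hA.swap_left x y x, hA.self_right, neg_zero]

theorem add_mid (x y a b : Q) : A x (a + b) y = A x a y + A x b y := by
  rw [hA.swap_left (a + b), hA.add_left, hA.swap_left a, hA.swap_left b, neg_add]

/-- The deviation from the medial law; it measures how far a sum of multiples of generators is from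
being additive in the coefficients. The four-term form uses `3 A = 0`. -/
theorem interchange (u p v q : Q) : (u + p) + (v + q) =
    ((A u p q - A u p v - A u v q - A v p q : Center Q) : Q) + ((u + v) + (p + q)) := by
  rw [hA u p (v + q), hA.add_add_eq p v q, CommMoufangLoop.comm p v, hA v p q,
    Center.add_left_comm' (A v p q), Center.coe_add_coe_add (A v p q),
    Center.add_left_comm' _ u, hA.add_add_eq u v (p + q),
    Center.coe_add_coe_add, Center.coe_add_coe_add]
  congr 2
  have h1 := hA.three u p v
  have h2 := hA.three v p q
  rw [hA.add_right, hA.add_right, hA.swap_left v p q, hA.swap_right u p v, ← sub_eq_zero]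
  refine Eq.trans ?_ (show (A u p v + A u p v + A u p v) + (A v p q + A v p q + A v p q) = 0 by
    rw [h1, h2, add_zero])
  abel

section Scalars

variable {R : Type*} [CommRing R] (Φ : R →+* ZMod 3) [SMul R Q] [IsQuasimodule Φ Q]

theorem smul_left_of_mem {r : R} (hr : r ∈ RingHom.ker Φ) (x y z : Q) : A (r • x) y z = 0 :=
  hA.eq_of_add_eq (by rw [IsQuasimodule.smul_add_assoc r hr x y z]; simp)

/-- Scalar multiplication is an endomorphism, so `r • A x y z` is the associator of `r x, r y, r z`,
which vanishes because `r x` is central. -/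
theorem smul_of_mem {r : R} (hr : r ∈ RingHom.ker Φ) (x y z : Q) :
    letI := Center.module (Q := Q) Φ
    r • A x y z = 0 := by
  let _ := Center.module (Q := Q) Φ
  rw [← hA.smul_left_of_mem Φ hr x (r • y) (r • z)]
  refine (hA.eq_of_add_eq ?_).symm
  rw [← IsQuasimodule.smul_add Φ, ← IsQuasimodule.smul_add Φ, ← IsQuasimodule.smul_add Φ,
    ← IsQuasimodule.smul_add Φ, hA x y z, IsQuasimodule.smul_add Φ]
  rfl

theorem smul_left (r : R) (x y z : Q) :
    letI := Center.module (Q := Q) Φ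
    A (r • x) y z = r • A x y z := by
  let _ := Center.module (Q := Q) Φ
  have h3 : ∀ a : ZMod 3, a = 0 ∨ a - 1 = 0 ∨ a - 1 - 1 = 0 := by decide
  have step : ∀ s : R, A ((s - 1) • x) y z = (s - 1) • A x y z → A (s • x) y z = s • A x y z := by
    intro s hs
    nth_rw 1 [← sub_add_cancel s 1]
    rw [IsQuasimodule.add_smul Φ, hA.add_left, hs, IsQuasimodule.one_smul Φ, sub_smul, one_smul,
      sub_add_cancel]
  have base : ∀ s : R, Φ s = 0 → A (s • x) y z = s • A x y z := fun s hs => by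
    rw [hA.smul_left_of_mem Φ hs, hA.smul_of_mem Φ hs]
  rcases h3 (Φ r) with h | h | h
  · exact base r h
  · exact step r (base _ (by simpa using h))
  · exact step r (step _ (base _ (by simpa using h)))

theorem smul_mid (r : R) (x y z : Q) :
    letI := Center.module (Q := Q) Φ
    A x (r • y) z = r • A x y z := by
  let _ := Center.module (Q := Q) Φ
  rw [hA.swap_left (r • y), hA.smul_left Φ, hA.swap_left y x, smul_neg]

theorem smul_right (r : R) (x y z : Q) :
    letI := Center.module (Q := Q) Φ
    A x y (r • z) = r • A x y z := by
  let _ := Center.module (Q := Q) Φ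
  rw [hA.swap_right x (r • z), hA.smul_mid Φ, hA.swap_right x z, smul_neg]

end Scalars

end IsCentralAssociator

end CommMoufangLoop

/-! ### Hamiltonian quasimodules have central associators -/

namespace CommMoufangLoop

/-- A normal subquasimodule is the class of `0` of some congruence. -/
theorem exists_con_of_isNormal {R Q : Type*} [AddZeroClass Q] [SMul R Q]
    {P : Subquasimodule R Q} (hP : P.IsNormal) :
    ∃ c : ModuleCon R Q, ∀ x, x ∈ P.carrier ↔ c.toSetoid x 0 := by
  obtain ⟨c, y, hy⟩ := hP
  refine ⟨c, fun x => ?_⟩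
  have h0 : c.toSetoid 0 y := by
    have := P.zero_mem
    rwa [hy] at this
  rw [hy]
  exact ⟨fun h => c.toSetoid.trans h (c.toSetoid.symm h0), fun h => c.toSetoid.trans h h0⟩

variable {Q : Type*} [CommMoufangLoop Q] {R : Type*} [CommRing R] (Φ : R →+* ZMod 3) [SMul R Q]
  [IsQuasimodule Φ Q]

include Φ

theorem neg_smul_add_self (x : Q) : (-1 : R) • x + x = 0 := by
  simpa using neg_smul_add_cancel_left Φ x 0

theorem smul_zero' (r : R) : r • (0 : Q) = 0 := by
  have h := IsQuasimodule.mul_smul Φ r 0 (0 : Q)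
  rw [mul_zero, IsQuasimodule.zero_smul Φ] at h
  exact h.symm

theorem smul_assoc_of_sub_mem {r s : R} (h : r - s ∈ RingHom.ker Φ) {x y z : Q}
    (hs : s • x + (y + z) = (s • x + y) + z) : r • x + (y + z) = (r • x + y) + z := by
  have hc : ∀ u v : Q, (r - s) • x + (u + v) = ((r - s) • x + u) + v :=
    IsQuasimodule.smul_add_assoc _ h x
  rw [← sub_add_cancel r s, IsQuasimodule.add_smul Φ, ← hc, ← hc, ← hc, hs]

/-- Central multiples do not affect associativity, so `r` may be replaced by 0, 1 or -1, where the
identity is trivial, a case of the Moufang law, or cancellation. -/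
theorem smul_self_assoc (r : R) (y z : Q) : r • y + (y + z) = (r • y + y) + z := by
  have h3 : ∀ a : ZMod 3, a - 0 = 0 ∨ a - 1 = 0 ∨ a - (-1) = 0 := by decide
  rcases h3 (Φ r) with h | h | h
  · refine smul_assoc_of_sub_mem Φ (s := 0) (by simpa using h) ?_
    rw [IsQuasimodule.zero_smul Φ, zero_add, zero_add]
  · refine smul_assoc_of_sub_mem Φ (s := 1) (by simpa [sub_eq_zero] using h) ?_
    rw [IsQuasimodule.one_smul Φ, add_self_add]
  · refine smul_assoc_of_sub_mem Φ (s := -1) (by simpa using h) ?_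
    rw [neg_smul_add_cancel_left Φ, neg_smul_add_self Φ, zero_add]

/-- Centrality of associators is not yet available here. The element `(z + z) + (y + y) = (z + y) +
(z + y)` is expanded in two ways by inserting `x + (-x) = 0`; the hypothesis identifies the factors
with `-x`, and cancelling them leaves the claim. -/
theorem assoc_of_neg_smul_assoc {x y z : Q}
    (h : (-1 : R) • x + (y + z) = ((-1 : R) • x + y) + z) : x + (y + z) = (x + y) + z := by
  have key : ∀ p q : Q, (z + z) + ((y + y) + (p + q)) = (z + (y + p)) + (z + (y + q)) := by
    intro p q
    rw [moufang y, moufang z]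
  have h1 := key x ((-1 : R) • x)
  have h2 := moufang (z + y) x ((-1 : R) • x)
  rw [CommMoufangLoop.comm x ((-1 : R) • x), neg_smul_add_self Φ, add_zero] at h1 h2
  rw [moufang z y y] at h1
  rw [h2, CommMoufangLoop.comm z (y + (-1 : R) • x), CommMoufangLoop.comm y ((-1 : R) • x), ← h,
    CommMoufangLoop.comm ((-1 : R) • x) (y + z), CommMoufangLoop.comm y z,
    CommMoufangLoop.comm (z + y + x), CommMoufangLoop.comm (z + (y + x))] at h1
  have h3 := add_left_inj' h1
  rw [CommMoufangLoop.comm x, CommMoufangLoop.comm x, CommMoufangLoop.comm y z, h3,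
    CommMoufangLoop.comm]

theorem assoc_of_smul_assoc {r : R} (hr : r ∉ RingHom.ker Φ) {x y z : Q}
    (h : r • x + (y + z) = (r • x + y) + z) : x + (y + z) = (x + y) + z := by
  have h3 : ∀ a : ZMod 3, a = 0 ∨ 1 - a = 0 ∨ -1 - a = 0 := by decide
  rcases h3 (Φ r) with h' | h' | h'
  · exact absurd h' hr
  · have := smul_assoc_of_sub_mem Φ (r := 1) (by simpa using h') h
    simpa only [IsQuasimodule.one_smul Φ] using this
  · exact assoc_of_neg_smul_assoc Φ (smul_assoc_of_sub_mem Φ (r := -1) (by simpa using h') h)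

/-- The cyclic subquasimodule generated by an element. -/
def cyclic (x : Q) : Subquasimodule R Q where
  carrier := Set.range fun r : R => r • x
  zero_mem := ⟨0, IsQuasimodule.zero_smul Φ x⟩
  add_mem := by
    rintro _ _ ⟨r, rfl⟩ ⟨s, rfl⟩
    exact ⟨r + s, IsQuasimodule.add_smul Φ r s x⟩
  smul_mem := by
    rintro r _ ⟨s, rfl⟩
    exact ⟨r * s, IsQuasimodule.mul_smul Φ r s x⟩

/-- A normal subquasimodule contains the associators of its elements. -/
theorem associator_mem_of_isNormal {P : Subquasimodule R Q} (hP : P.IsNormal) {x y z a : Q}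
    (h : x ∈ P.carrier ∨ y ∈ P.carrier ∨ z ∈ P.carrier) (ha : (x + (y + z)) + a = (x + y) + z) :
    a ∈ P.carrier := by
  obtain ⟨c, hc⟩ := exists_con_of_isNormal hP
  have h1 : a = (-1 : R) • (x + (y + z)) + ((x + y) + z) := by
    rw [← ha, neg_smul_add_cancel_left Φ]
  rw [hc, h1]
  -- Modulo the congruence the argument lying in `P` may be replaced by 0, and a triple containing 0
  -- associates.
  have key : ∀ x' y' z' : Q, c.toSetoid x x' → c.toSetoid y y' → c.toSetoid z z' → x' + (y' + z') = (x' + y') + z' →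
      c.toSetoid ((-1 : R) • (x + (y + z)) + ((x + y) + z)) 0 := by
    intro x' y' z' hx hy hz h'
    have := c.add (c.smul (-1 : R) (c.add hx (c.add hy hz))) (c.add (c.add hx hy) hz)
    rwa [h', neg_smul_add_self Φ] at this
  simp only [hc] at h
  rcases h with h | h | h
  · exact key 0 y z h (c.toSetoid.refl _) (c.toSetoid.refl _) (by simp)
  · exact key x 0 z (c.toSetoid.refl _) h (c.toSetoid.refl _) (by simp)
  · exact key x y 0 (c.toSetoid.refl _) (c.toSetoid.refl _) h (by simp)

/-- The associators of a hamiltonian quasimodule are central. -/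
theorem exists_isCentralAssociator (hQ : IsHamiltonianQuasimodule R Q) :
    ∃ A : Q → Q → Q → Center Q, IsCentralAssociator A := by
  have : ∀ x y z : Q, ∃ c : Center Q, (x + y) + z = c + (x + (y + z)) := by
    intro x y z
    obtain ⟨a, ha, -⟩ := existsUnique_add_left (x + (y + z)) ((x + y) + z)
    have hmem := fun t h => associator_mem_of_isNormal Φ (P := cyclic Φ t) (hQ _)
      (x := x) (y := y) (z := z) h ha
    have hself : ∀ t : Q, t ∈ (cyclic Φ t : Subquasimodule R Q).carrier :=
      fun t => ⟨1, IsQuasimodule.one_smul Φ t⟩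
    obtain ⟨r, hr : r • x = a⟩ := hmem x (Or.inl (hself x))
    obtain ⟨s, hs : s • y = a⟩ := hmem y (Or.inr (Or.inl (hself y)))
    by_cases hrI : r ∈ RingHom.ker Φ
    · refine ⟨⟨a, ?_⟩, ?_⟩
      · rw [← hr]
        exact IsQuasimodule.smul_add_assoc r hrI x
      · rw [← ha, CommMoufangLoop.comm]
    -- Here `r x = s y`, and `s y` associates with `y, z`; since `r` is congruent to 1 or -1 modulo
    -- `I`, so does `x`.
    · have h := smul_self_assoc Φ s y z
      rw [hs, ← hr] at h
      exact ⟨0, by rw [Center.coe_zero, zero_add, assoc_of_smul_assoc Φ hrI h]⟩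
  choose A hA using this
  exact ⟨A, hA⟩

end CommMoufangLoop

/-! ### The homomorphism from `q(F₃)` attached to a triple -/

namespace CommMoufangLoop.IsCentralAssociator

variable {Q : Type*} [CommMoufangLoop Q] {R : Type*} [CommRing R] {Φ : R →+* ZMod 3} [SMul R Q]
  [IsQuasimodule Φ Q] {A : Q → Q → Q → Center Q} (hA : IsCentralAssociator A)

include hA

/-- `q(F₃)` is free on three generators among the quasimodules with central associators. -/
theorem exists_hom_freeTernary (x₁ x₂ x₃ : Q) :
    ∃ g : (freeTernary Φ).Quasi → Q, IsQuasimoduleHom R g ∧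
      g ((0, 1) : FreeTernaryCarrier Φ) = A x₁ x₂ x₃ := by
  let _ := Center.module (Q := Q) Φ
  let c := A x₁ x₂ x₃
  -- The map `P → Center Q` sending 1 to the associator is well defined because `I` kills
  -- associators.
  let l : (R ⧸ RingHom.ker Φ) →ₗ[R] Center Q :=
    (RingHom.ker Φ).liftQ (LinearMap.toSpanSingleton R (Center Q) c) fun r hr => by
      rw [LinearMap.mem_ker, LinearMap.toSpanSingleton_apply]
      exact hA.smul_of_mem Φ hr x₁ x₂ x₃
  have hl : ∀ r : R, l (Submodule.Quotient.mk r) = r • c := fun r => rfl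
  have hl1 : l 1 = c := (hl 1).trans (one_smul R c)
  let g : FreeTernaryCarrier Φ → Q := fun u =>
    (l u.2 : Q) + ((u.1 0 • x₁ + u.1 1 • x₂) + u.1 2 • x₃)
  refine ⟨g, ⟨?_, ?_⟩, ?_⟩
  · intro (u : FreeTernaryCarrier Φ) (v : FreeTernaryCarrier Φ)
    change g ((freeTernary Φ).op u v) = g u + g v
    have hτ : (freeTernary Φ).op u v = (u.1 + v.1, u.2 + v.2 +
        Submodule.Quotient.mk ((u.1 0 * v.1 1 - u.1 1 * v.1 0) * (u.1 2 - v.1 2))) := by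
      refine Prod.ext ?_ ?_
      · simp [TernaryAlgebra.op, freeTernary]
      · simp [TernaryAlgebra.op, freeTernary]
        rfl
    simp only [g, hτ, map_add, hl]
    -- Two interchanges collect the multiples of each `xᵢ`; the central corrections, expanded by
    -- trilinearity and alternation, must match the `τ` term of the loop operation.
    rw [Center.add_assoc', Center.add_left_comm', Center.coe_add_coe_add,
      hA.interchange (u.1 0 • x₁ + u.1 1 • x₂) (u.1 2 • x₃),
      hA.interchange (u.1 0 • x₁) (u.1 1 • x₂), Center.add_assoc', Center.coe_add_coe_add,
      Center.coe_add_coe_add]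
    simp only [Pi.add_apply, IsQuasimodule.add_smul Φ]
    congr 2
    simp only [hA.add_left, hA.add_mid, hA.add_right, hA.smul_left Φ, hA.smul_mid Φ,
      hA.smul_right Φ, hA.self_left, hA.self_mid, hA.self_right, smul_zero,
      hA.swap_right x₁ x₂ x₃, hA.swap_left x₁ x₂ x₃]
    rw [hA.swap_right x₂ x₁ x₃, hA.swap_left x₁ x₂ x₃]
    change _ + _ + _ • A x₁ x₂ x₃ = _
    module
  · intro r (u : FreeTernaryCarrier Φ)
    change (l (r • u.2) : Q) + (((r * u.1 0) • x₁ + (r * u.1 1) • x₂) + (r * u.1 2) • x₃) = r • g u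
    simp only [g, map_smul, IsQuasimodule.mul_smul Φ, IsQuasimodule.smul_add Φ]
    rfl
  · simp [g, hl1, IsQuasimodule.zero_smul Φ, c]

end CommMoufangLoop.IsCentralAssociator

/-! ### Cocyclic and torsion modules -/

section Modules

variable {R : Type*} [CommRing R]

/-- The working form of cocyclicity: a non-zero element of every non-zero submodule spans the socle.
-/
theorem isCocyclicModule_iff {M : Type*} [AddCommGroup M] [Module R M] :
    IsCocyclicModule R M ↔ ∃ s : M, s ≠ 0 ∧ ∀ N : Submodule R M, N ≠ ⊥ → s ∈ N := by
  constructor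
  · rintro ⟨h1, h2⟩
    have hat : IsAtom (moduleSocle R M) := isSimpleModule_iff_isAtom.1 h1
    obtain ⟨s, hs, hs0⟩ := Submodule.exists_mem_ne_zero_of_ne_bot hat.1
    refine ⟨s, hs0, fun N hN => ?_⟩
    have := (hat.le_iff.1 (inf_le_left : moduleSocle R M ⊓ N ≤ _)).resolve_left (h2 N hN)
    exact (this.ge.trans inf_le_right) hs
  · rintro ⟨s, hs0, hs⟩
    have hle : ∀ N : Submodule R M, N ≠ ⊥ → Submodule.span R {s} ≤ N := fun N hN =>
      (Submodule.span_singleton_le_iff_mem _ _).2 (hs N hN)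
    have hat : IsAtom (Submodule.span R {s}) := by
      refine ⟨by simpa using hs0, fun N hN => ?_⟩
      by_contra h
      exact hN.not_ge (hle N h)
    have heq : moduleSocle R M = Submodule.span R {s} := by
      refine le_antisymm (sSup_le fun N hN => ?_) (le_sSup hat)
      exact ((IsAtom.le_iff hN).1 (hle N hN.1)).resolve_left hat.1 |>.ge
    refine ⟨?_, fun N hN => ?_⟩
    · rw [heq]
      exact isSimpleModule_iff_isAtom.2 hat
    · rw [heq, inf_eq_left.2 (hle N hN)]
      exact hat.1

variable (Φ : R →+* ZMod 3) {M : Type*} [AddCommGroup M] [Module R M]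

theorem mem_primitiveStep {N : Submodule R M} {x : M} :
    x ∈ primitiveStep Φ N ↔ ∀ i ∈ RingHom.ker Φ, i • x ∈ N := by
  simp only [primitiveStep, primitivePart, Submodule.mem_comap, Submodule.mem_torsionBySet_iff,
    Submodule.mkQ_apply, ← Submodule.Quotient.mk_smul, Submodule.Quotient.mk_eq_zero]
  exact ⟨fun h i hi => h ⟨i, hi⟩, fun h i => h i.1 i.2⟩

variable {Φ}

/-- For fixed `i`, the elements killed by some power of `i` form a submodule. It contains each stage
of the transfinite chain, since a step costs one further factor `i`. -/
theorem IsPrimitiveTorsion.exists_pow_smul_eq_zero (hM : IsPrimitiveTorsion Φ M) {i : R}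
    (hi : i ∈ RingHom.ker Φ) (x : M) : ∃ n : ℕ, i ^ n • x = 0 := by
  let T : Submodule R M :=
    { carrier := {x | ∃ n : ℕ, i ^ n • x = 0}
      zero_mem' := ⟨0, smul_zero _⟩
      add_mem' := by
        rintro a b ⟨n, hn⟩ ⟨m, hm⟩
        refine ⟨n + m, ?_⟩
        rw [smul_add]
        nth_rw 1 [add_comm n m]
        rw [pow_add, pow_add, mul_smul, mul_smul, hn, hm, smul_zero, smul_zero, add_zero]
      smul_mem' := by
        rintro r a ⟨n, hn⟩
        exact ⟨n, by rw [smul_comm, hn, smul_zero]⟩ }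
  suffices h : primitiveRadical Φ M ≤ T by
    rw [hM] at h
    exact h (Submodule.mem_top (x := x))
  refine iSup_le fun α => ?_
  induction α using SuccOrder.limitRecOn with
  | isMin α hα =>
    rw [hα.eq_bot, transfiniteIterate_bot]
    exact bot_le
  | succ α _ ih =>
    rw [transfiniteIterate_succ _ _ _ (not_isMax α)]
    intro y hy
    obtain ⟨n, hn⟩ := ih ((mem_primitiveStep Φ).1 hy i hi)
    exact ⟨n + 1, by rw [pow_succ, mul_smul, hn]⟩
  | isSuccLimit α hα ih =>
    rw [transfiniteIterate_limit _ _ _ hα]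
    exact iSup_le fun β => ih β.1 β.2

theorem isPrimitiveTorsion_of_pow_smul {n : ℕ}
    (h : ∀ r ∈ RingHom.ker Φ ^ n, ∀ x : M, r • x = 0) : IsPrimitiveTorsion Φ M := by
  have key : ∀ (k : ℕ) (x : M), (∀ r ∈ RingHom.ker Φ ^ k, r • x = 0) →
      x ∈ transfiniteIterate (primitiveStep Φ) (k : Ordinal) (⊥ : Submodule R M) := by
    intro k
    induction k with
    | zero =>
      intro x hx
      have := hx 1 (by simp)
      rw [one_smul] at this
      rw [this]
      exact zero_mem _
    | succ k ih =>
      intro x hx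
      rw [Nat.cast_succ, ← Order.succ_eq_add_one, transfiniteIterate_succ _ _ _ (not_isMax _)]
      refine (mem_primitiveStep Φ).2 fun i hi => ih _ fun r hr => ?_
      rw [smul_smul]
      exact hx _ (by rw [pow_succ]; exact Ideal.mul_mem_mul hr hi)
  refine eq_top_iff.2 fun x _ => ?_
  exact (le_iSup (fun α => transfiniteIterate (primitiveStep Φ) α (⊥ : Submodule R M)) _)
    (key n x fun r hr => h r hr x)

theorem one_sub_sq_mem_ker {r : R} (hr : r ∉ RingHom.ker Φ) : 1 - r ^ 2 ∈ RingHom.ker Φ := by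
  have h3 : ∀ a : ZMod 3, a ≠ 0 → 1 - a ^ 2 = 0 := by decide
  rw [RingHom.mem_ker, map_sub, map_one, map_pow]
  exact h3 _ hr

/-- Scalars outside the kernel of `Φ` act invertibly on torsion modules. -/
theorem IsPrimitiveTorsion.exists_smul_smul_eq (hM : IsPrimitiveTorsion Φ M) {r : R}
    (hr : r ∉ RingHom.ker Φ) (x : M) : ∃ t : R, t • r • x = x := by
  obtain ⟨n, hn⟩ := hM.exists_pow_smul_eq_zero (one_sub_sq_mem_ker hr) x
  -- A geometric sum: `r²` divides `1 - (1 - r²)ⁿ`, which acts as the identity on `x`.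
  obtain ⟨t, ht⟩ := sub_dvd_pow_sub_pow (1 : R) (1 - r ^ 2) n
  rw [one_pow, sub_sub_cancel] at ht
  refine ⟨t * r, ?_⟩
  have h : (1 : R) • x = (r ^ 2 * t) • x := by
    rw [← ht, sub_smul, hn, sub_zero]
  rw [smul_smul, mul_assoc, mul_comm, ← sq, ← h, one_smul]

/-- If `i s ≠ 0`, then `s = r i s` for some `r`; iterating gives `s = rⁿ iⁿ s`, which is 0 for large
`n`. -/
theorem IsPrimitiveTorsion.smul_eq_zero_of_essential (hM : IsPrimitiveTorsion Φ M) {s : M}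
    (hs : ∀ N : Submodule R M, N ≠ ⊥ → s ∈ N) {i : R} (hi : i ∈ RingHom.ker Φ) : i • s = 0 := by
  by_contra h
  have hmem := hs (Submodule.span R {i • s}) (by simpa using h)
  obtain ⟨r, hr⟩ := Submodule.mem_span_singleton.1 hmem
  obtain ⟨n, hn⟩ := hM.exists_pow_smul_eq_zero hi s
  have hpow : ∀ k : ℕ, (r ^ k * i ^ k) • s = s := by
    intro k
    induction k with
    | zero => simp
    | succ k ih =>
      nth_rw 2 [← ih]
      nth_rw 2 [← hr]
      rw [smul_smul, smul_smul]
      congr 1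
      ring
  have := hpow n
  rw [mul_smul, hn, smul_zero] at this
  rw [← this, smul_zero] at h
  exact h rfl

/-- Any three members of a minimal generating set will do: if fewer elements generated their span,
exchanging them would shorten the generating set of `M`. -/
theorem exists_linearMap_spanFinrank_range_eq_three (hM : (⊤ : Submodule R M).FG)
    (h3 : 3 ≤ (⊤ : Submodule R M).spanFinrank) :
    ∃ π : (Fin 3 → R) →ₗ[R] M, (LinearMap.range π).spanFinrank = 3 := by
  classical
  obtain ⟨s, hcard, hspan⟩ := hM.exists_span_finset_card_eq_spanFinrank
  obtain ⟨t, hts, ht⟩ := Finset.exists_subset_card_eq (h3.trans hcard.ge)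
  let e : Fin 3 ≃ t := (Fintype.equivFinOfCardEq (by simpa using ht)).symm
  refine ⟨Fintype.linearCombination R fun j => (e j : M), ?_⟩
  have hrange : Set.range (fun j => (e j : M)) = (t : Set M) := by
    have : (fun j => (e j : M)) = Subtype.val ∘ e := rfl
    rw [this, Set.range_comp, e.surjective.range_eq, Set.image_univ]
    simp
  rw [Fintype.range_linearCombination, hrange]
  refine le_antisymm ?_ ?_
  · refine (Submodule.spanFinrank_span_le_ncard_of_finite t.finite_toSet).trans ?_
    rw [Set.ncard_coe_finset, ht]
  · obtain ⟨u, hu, huspan⟩ := (Submodule.fg_span t.finite_toSet :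
      (Submodule.span R (t : Set M)).FG).exists_span_finset_card_eq_spanFinrank
    have htop : Submodule.span R ((u ∪ (s \ t) : Finset M) : Set M) = ⊤ := by
      rw [Finset.coe_union, Submodule.span_union, huspan, ← Submodule.span_union,
        ← Finset.coe_union, Finset.union_sdiff_of_subset hts, hspan]
    have h1 := Submodule.spanFinrank_span_le_ncard_of_finite (R := R)
      (u ∪ (s \ t) : Finset M).finite_toSet
    rw [htop, Set.ncard_coe_finset, ← hcard] at h1
    have h2 := Finset.card_union_le u (s \ t)
    have h4 := Finset.card_sdiff_add_card_eq_card hts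
    omega

/-- If the image of `R³` needs three generators, then the preimage of the socle lies in `I R³`. -/
theorem apply_mem_ker_of_map_mem_span (hM : IsPrimitiveTorsion Φ M) {s : M}
    (hs : ∀ N : Submodule R M, N ≠ ⊥ → s ∈ N) {π : (Fin 3 → R) →ₗ[R] M}
    (hπ : (LinearMap.range π).spanFinrank = 3) {y : Fin 3 → R}
    (hy : π y ∈ Submodule.span R {s}) (j : Fin 3) : y j ∈ RingHom.ker Φ := by
  classical
  by_contra hj
  let v : Fin 3 → M := fun k => π fun i => if k = i then 1 else 0
  have hπv : ∀ z : Fin 3 → R, π z = ∑ k, z k • v k := fun z => LinearMap.pi_apply_eq_sum_univ π z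
  let L : Submodule R M := Submodule.span R ((Finset.univ.erase j).image v : Finset M)
  have hvL : ∀ k, k ≠ j → v k ∈ L := fun k hk => Submodule.subset_span (by
    simpa using ⟨k, hk, rfl⟩)
  -- If `y j` is outside `I`, it acts invertibly, so `v j` can be solved for in terms of `π y` and
  -- the other two generators.
  have hle : LinearMap.range π ≤ Submodule.span R {π y} ⊔ L := by
    have hvj : v j ∈ Submodule.span R {π y} ⊔ L := by
      obtain ⟨t, ht⟩ := hM.exists_smul_smul_eq hj (v j)
      rw [← ht]
      refine Submodule.smul_mem _ _ ?_
      have h1 : y j • v j = π y - ∑ k ∈ Finset.univ.erase j, y k • v k := by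
        rw [hπv, ← Finset.add_sum_erase _ _ (Finset.mem_univ j), add_sub_cancel_right]
      rw [h1]
      refine Submodule.sub_mem _
        (Submodule.mem_sup_left (Submodule.mem_span_singleton_self _))
        (Submodule.mem_sup_right (Submodule.sum_mem _ fun k hk => ?_))
      exact Submodule.smul_mem _ _ (hvL k (Finset.ne_of_mem_erase hk))
    rintro _ ⟨z, rfl⟩
    rw [hπv z]
    refine Submodule.sum_mem _ fun k _ => Submodule.smul_mem _ _ ?_
    by_cases hk : k = j
    · rw [hk]
      exact hvj
    · exact Submodule.mem_sup_right (hvL k hk)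
  have hLrange : L ≤ LinearMap.range π := by
    refine Submodule.span_le.2 fun x hx => ?_
    obtain ⟨k, -, rfl⟩ := Finset.mem_image.1 hx
    exact ⟨_, rfl⟩
  by_cases hL : L = ⊥
  · rw [hL, sup_bot_eq] at hle
    have heq : LinearMap.range π = Submodule.span R {π y} :=
      le_antisymm hle ((Submodule.span_singleton_le_iff_mem _ _).2 ⟨y, rfl⟩)
    have := Submodule.spanFinrank_span_le_ncard_of_finite (R := R) (Set.finite_singleton (π y))
    rw [← heq, hπ, Set.ncard_singleton] at this
    omega
  -- A non-zero `L` contains `s` and hence `π y`, so the two generators of `L` already suffice.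
  · have hyL : Submodule.span R {π y} ≤ L :=
      (Submodule.span_singleton_le_iff_mem _ _).2
        ((Submodule.span_singleton_le_iff_mem _ _).2 (hs L hL) hy)
    rw [sup_eq_right.2 hyL] at hle
    have heq := le_antisymm hle hLrange
    have := Submodule.spanFinrank_span_le_ncard_of_finite (R := R)
      ((Finset.univ.erase j).image v : Finset M).finite_toSet
    rw [Set.ncard_coe_finset] at this
    change L.spanFinrank ≤ _ at this
    have h2 := Finset.card_image_le (s := Finset.univ.erase j) (f := v)
    rw [Finset.card_erase_of_mem (Finset.mem_univ j), Finset.card_univ, Fintype.card_fin] at h2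
    rw [← heq, hπ] at this
    omega

theorem torsionOf_eq_ker (hM : IsPrimitiveTorsion Φ M) {s : M} (hs0 : s ≠ 0)
    (hs : ∀ N : Submodule R M, N ≠ ⊥ → s ∈ N) : Ideal.torsionOf R M s = RingHom.ker Φ := by
  ext r
  rw [Ideal.mem_torsionOf_iff]
  refine ⟨fun h => ?_, fun h => hM.smul_eq_zero_of_essential hs h⟩
  by_contra hr
  obtain ⟨t, ht⟩ := hM.exists_smul_smul_eq hr s
  rw [h, smul_zero] at ht
  exact hs0 ht.symm

theorem exists_submodule_linearMap_quotient (hM : IsPrimitiveTorsion Φ M) {s : M} (hs0 : s ≠ 0)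
    (hs : ∀ N : Submodule R M, N ≠ ⊥ → s ∈ N) {E : Type*} [AddCommGroup E] [Module R E]
    {π : E →ₗ[R] M} (hπ : LinearMap.range π ≠ ⊥) :
    ∃ (A : Submodule R E) (φ : A →ₗ[R] R ⧸ RingHom.ker Φ),
      Function.Surjective φ ∧ (LinearMap.ker φ).map A.subtype = LinearMap.ker π := by
  -- `A` is the preimage of the socle `R s`, and `φ` is `π` followed by `R s ≅ R / ann s = P`.
  let S := Submodule.span R {s}
  let e : (R ⧸ RingHom.ker Φ) ≃ₗ[R] S :=
    (Submodule.quotEquivOfEq _ _ (torsionOf_eq_ker hM hs0 hs).symm).trans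
      (Ideal.quotTorsionOfEquivSpanSingleton R M s)
  let ψ : S.comap π →ₗ[R] S := π.restrict fun x hx => hx
  refine ⟨S.comap π, e.symm.toLinearMap ∘ₗ ψ, ?_, ?_⟩
  · refine e.symm.surjective.comp ?_
    rintro ⟨x, hx⟩
    have hle : S ≤ LinearMap.range π :=
      (Submodule.span_singleton_le_iff_mem _ _).2 (hs _ hπ)
    obtain ⟨y, rfl⟩ := hle hx
    exact ⟨⟨y, hx⟩, rfl⟩
  · ext y
    simp only [Submodule.mem_map, LinearMap.mem_ker, LinearMap.comp_apply,
      LinearEquiv.coe_coe, LinearEquiv.map_eq_zero_iff]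
    constructor
    · rintro ⟨y, hy, rfl⟩
      exact congrArg Subtype.val hy
    · intro hy
      exact ⟨⟨y, by simp [hy]⟩, Subtype.ext hy, rfl⟩

end Modules

/-! ### Quotients of ternary algebras and a hamiltonian criterion -/

namespace TernaryAlgebra

variable {R : Type*} [CommRing R] {Φ : R →+* ZMod 3} {A : Type*} [AddCommGroup A] [Module R A]
  {B : Type*} [AddCommGroup B] [Module R B]

/-- The ternary algebra induced on the image of a surjective linear map whose kernel is
annihilated by the trilinear map. -/
noncomputable def push (T : TernaryAlgebra Φ A) (f : A →ₗ[R] B) (hf : Function.Surjective f)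
    (hl : ∀ v ∈ LinearMap.ker f, ∀ x y, T.τ v x y = 0)
    (hr : ∀ v ∈ LinearMap.ker f, ∀ x y, T.τ x y v = 0) :
    {S : TernaryAlgebra Φ B // ∀ x y z, S.τ (f x) (f y) (f z) = f (T.τ x y z)} := by
  let s : B → A := Function.surjInv hf
  have hs : ∀ a, s (f a) - a ∈ LinearMap.ker f := fun a => by
    rw [LinearMap.mem_ker, map_sub, Function.surjInv_eq hf, sub_self]
  -- The value does not depend on the chosen lifts; the middle argument is handled by antisymmetry.
  have key : ∀ a b c : A, T.τ (s (f a)) (s (f b)) (s (f c)) = T.τ a b c := by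
    intro a b c
    have h1 : T.τ (s (f a)) = T.τ a := by
      ext x y
      have := hl _ (hs a) x y
      rwa [map_sub, LinearMap.sub_apply, LinearMap.sub_apply, sub_eq_zero] at this
    have h2 : T.τ a (s (f b)) = T.τ a b := by
      ext y
      have := hl _ (hs b) a y
      rwa [T.τ_swap, neg_eq_zero, map_sub, LinearMap.sub_apply, sub_eq_zero] at this
    have h3 := hr _ (hs c) a b
    rw [map_sub, sub_eq_zero] at h3
    rw [h1, h2, h3]
  let t : B →ₗ[R] B →ₗ[R] B →ₗ[R] B := LinearMap.mk₂ R
    (fun x y =>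
      { toFun := fun z => f (T.τ (s x) (s y) (s z))
        map_add' := fun a b => by
          obtain ⟨x, rfl⟩ := hf x
          obtain ⟨y, rfl⟩ := hf y
          obtain ⟨a, rfl⟩ := hf a
          obtain ⟨b, rfl⟩ := hf b
          simp only [← map_add, key]
        map_smul' := fun r a => by
          obtain ⟨x, rfl⟩ := hf x
          obtain ⟨y, rfl⟩ := hf y
          obtain ⟨a, rfl⟩ := hf a
          simp only [← map_smul, key, RingHom.id_apply] })
    (fun x x' y => by
      ext z
      obtain ⟨x, rfl⟩ := hf x
      obtain ⟨x', rfl⟩ := hf x'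
      obtain ⟨y, rfl⟩ := hf y
      obtain ⟨z, rfl⟩ := hf z
      simp only [LinearMap.coe_mk, AddHom.coe_mk, LinearMap.add_apply]
      rw [← map_add f, key, key, key, ← map_add f, map_add T.τ]
      rfl)
    (fun r x y => by
      ext z
      obtain ⟨x, rfl⟩ := hf x
      obtain ⟨y, rfl⟩ := hf y
      obtain ⟨z, rfl⟩ := hf z
      simp only [LinearMap.coe_mk, AddHom.coe_mk, LinearMap.smul_apply]
      rw [← map_smul f, key, key, ← map_smul f, map_smul T.τ]
      rfl)
    (fun x y y' => by
      ext z
      obtain ⟨x, rfl⟩ := hf x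
      obtain ⟨y, rfl⟩ := hf y
      obtain ⟨y', rfl⟩ := hf y'
      obtain ⟨z, rfl⟩ := hf z
      simp only [LinearMap.coe_mk, AddHom.coe_mk, LinearMap.add_apply]
      rw [← map_add f, key, key, key, ← map_add f, map_add (T.τ x)]
      rfl)
    (fun r x y => by
      ext z
      obtain ⟨x, rfl⟩ := hf x
      obtain ⟨y, rfl⟩ := hf y
      obtain ⟨z, rfl⟩ := hf z
      simp only [LinearMap.coe_mk, AddHom.coe_mk, LinearMap.smul_apply]
      rw [← map_smul f, key, key, ← map_smul f, map_smul (T.τ x)]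
      rfl)
  have ht : ∀ x y z, t (f x) (f y) (f z) = f (T.τ x y z) := fun x y z =>
    congrArg f (key x y z)
  refine ⟨⟨t, ?_, ?_, ?_, ?_⟩, ht⟩
  · intro r hr' x y z
    obtain ⟨x, rfl⟩ := hf x
    obtain ⟨y, rfl⟩ := hf y
    obtain ⟨z, rfl⟩ := hf z
    rw [ht, ← map_smul, T.smul_τ r hr', map_zero]
  · intro x y
    obtain ⟨x, rfl⟩ := hf x
    obtain ⟨y, rfl⟩ := hf y
    rw [ht, T.τ_self, map_zero]
  · intro x y z a b
    obtain ⟨x, rfl⟩ := hf x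
    obtain ⟨y, rfl⟩ := hf y
    obtain ⟨z, rfl⟩ := hf z
    obtain ⟨a, rfl⟩ := hf a
    obtain ⟨b, rfl⟩ := hf b
    rw [ht, ht, T.τ_τ_left, map_zero]
  · intro x y z a b
    obtain ⟨x, rfl⟩ := hf x
    obtain ⟨y, rfl⟩ := hf y
    obtain ⟨z, rfl⟩ := hf z
    obtain ⟨a, rfl⟩ := hf a
    obtain ⟨b, rfl⟩ := hf b
    rw [ht, ht, T.τ_τ_right, map_zero]

theorem op_τ (T : TernaryAlgebra Φ A) (u x y z : A) :
    T.op u (T.τ x y z) = u + T.τ x y z := by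
  rw [op, T.τ_τ_mid, add_zero]

/-- If some element lies in every non-zero submodule, and the values of the trilinear map are
multiples of it, then the quasimodule is hamiltonian. -/
theorem isHamiltonianQuasimodule (T : TernaryAlgebra Φ A) {e : A}
    (he : ∀ N : Submodule R A, N ≠ ⊥ → e ∈ N)
    (hτ : ∀ x y z, T.τ x y z ∈ Submodule.span R {e}) :
    IsHamiltonianQuasimodule R T.Quasi := by
  intro P
  have hsmul : ∀ (r : R) (x : A), x ∈ P.carrier → (r • x : A) ∈ P.carrier :=
    fun r x hx => P.smul_mem r hx
  have hmem : ∀ x : A, x ∈ P.carrier → x ≠ 0 → ∀ a b c, T.τ a b c ∈ P.carrier := by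
    intro x hx hx0 a b c
    obtain ⟨r, hr⟩ := Submodule.mem_span_singleton.1 (he (Submodule.span R {x}) (by simpa using hx0))
    obtain ⟨r', hr'⟩ := Submodule.mem_span_singleton.1 (hτ a b c)
    rw [← hr', ← hr]
    exact hsmul _ _ (hsmul _ _ hx)
  have hadd : ∀ x y : A, x ∈ P.carrier → y ∈ P.carrier → (x + y : A) ∈ P.carrier := by
    intro x y hx hy
    by_cases hx0 : x = 0
    · rwa [hx0, zero_add]
    · have h1 : T.op x y ∈ P.carrier := P.add_mem hx hy
      -- Adding the opposite `τ` term, which lies in `P`, turns the loop sum into the module sum.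
      have h2 : T.op (T.op x y) (T.τ y x (x - y)) ∈ P.carrier :=
        P.add_mem h1 (hmem x hx hx0 _ _ _)
      have h3 : T.op (T.op x y) (T.τ y x (x - y)) = x + y := by
        rw [T.op_τ, op, T.τ_swap x y, add_neg_cancel_right]
      rwa [h3] at h2
  let S : Submodule R A :=
    { carrier := P.carrier
      zero_mem' := P.zero_mem
      add_mem' := fun {x y} => hadd x y
      smul_mem' := hsmul }
  have hS : ∀ x ∈ S, x ≠ 0 → ∀ a b c, T.τ a b c ∈ S := hmem
  have hcon : ∀ a b c d : A, a - b ∈ S → c - d ∈ S → T.op a c - T.op b d ∈ S := by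
    intro a b c d hab hcd
    by_cases hSb : S = ⊥
    · rw [hSb, Submodule.mem_bot, sub_eq_zero] at hab hcd
      rw [hab, hcd, sub_self]
      exact zero_mem S
    · obtain ⟨x, hx, hx0⟩ := Submodule.exists_mem_ne_zero_of_ne_bot hSb
      have h : T.op a c - T.op b d
          = (a - b) + (c - d) + (T.τ a c (a - c) - T.τ b d (b - d)) := by
        simp only [op]
        abel
      rw [h]
      exact S.add_mem (S.add_mem hab hcd) (S.sub_mem (hS x hx hx0 _ _ _) (hS x hx hx0 _ _ _))
  let c : ModuleCon R T.Quasi :=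
    { r := fun a b : A => a - b ∈ S
      iseqv :=
        ⟨fun a : A => by rw [sub_self]; exact zero_mem S,
          fun {a b : A} (h : a - b ∈ S) => by rw [← neg_sub]; exact S.neg_mem h,
          fun {a b c : A} (h : a - b ∈ S) (h' : b - c ∈ S) => by
            rw [← sub_add_sub_cancel a b c]; exact S.add_mem h h'⟩
      add' := fun {a b c d : A} h h' => hcon a b c d h h'
      smul := fun r {a b : A} (h : a - b ∈ S) => by
        change (r • a : A) - (r • b : A) ∈ S
        rw [← smul_sub]
        exact S.smul_mem r h }
  have h0 : ∀ x : A, x ∈ S ↔ x - 0 ∈ S := fun x => by rw [sub_zero]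
  exact ⟨c, (0 : A), Set.ext h0⟩

end TernaryAlgebra

/-! ### Non-associative hamiltonian quotients of `q(F₃)` -/

section Free

variable {R : Type*} [CommRing R] {Φ : R →+* ZMod 3}

theorem freeTernary_τ (x y z : FreeTernaryCarrier Φ) : (freeTernary Φ).τ x y z =
    (0, Submodule.Quotient.mk ((x.1 0 * y.1 1 - x.1 1 * y.1 0) * z.1 2)) :=
  Prod.ext (by simp [freeTernary]) (by simp [freeTernary]; rfl)

theorem freeTernary_τ_left_eq_zero {v : FreeTernaryCarrier Φ} (hv : ∀ j, v.1 j ∈ RingHom.ker Φ)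
    (x y : FreeTernaryCarrier Φ) : (freeTernary Φ).τ v x y = 0 := by
  rw [freeTernary_τ]
  refine Prod.ext rfl ((Submodule.Quotient.mk_eq_zero _).2 ?_)
  exact Ideal.mul_mem_right _ _ (Ideal.sub_mem _ (Ideal.mul_mem_right _ _ (hv 0))
    (Ideal.mul_mem_right _ _ (hv 1)))

theorem freeTernary_τ_right_eq_zero {v : FreeTernaryCarrier Φ} (hv : ∀ j, v.1 j ∈ RingHom.ker Φ)
    (x y : FreeTernaryCarrier Φ) : (freeTernary Φ).τ x y v = 0 := by
  rw [freeTernary_τ]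
  refine Prod.ext rfl ((Submodule.Quotient.mk_eq_zero _).2 ?_)
  exact Ideal.mul_mem_left _ _ (hv 2)

theorem mk_mem_span_inr_one (r : R) : ((0, Submodule.Quotient.mk r) : FreeTernaryCarrier Φ) ∈
    Submodule.span R {((0, 1) : FreeTernaryCarrier Φ)} :=
  Submodule.mem_span_singleton.2 ⟨r, by
    rw [Prod.smul_mk, smul_zero, Algebra.smul_def, mul_one]
    rfl⟩

/-- The two arguments of `f` are the two bracketings of `a₁, a₂, a₃` in `q(F₃)`; they differ by
`a₄`. -/
theorem map_eq_of_isAssociativeLoop {B : Type*} [Add B]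
    {f : FreeTernaryCarrier Φ → B} (hB : IsAssociativeLoop B)
    (hf : ∀ x y, f ((freeTernary Φ).op x y) = f x + f y) :
    f (![1, 1, 1], 0) = f (![1, 1, 1], -1) := by
  have h := hB (f (![1, 0, 0], 0)) (f (![0, 1, 0], 0)) (f (![0, 0, 1], 0))
  rw [← hf, ← hf, ← hf, ← hf] at h
  convert h using 2
  · refine Prod.ext ?_ ?_
    · funext j
      fin_cases j <;> simp [TernaryAlgebra.op, freeTernary_τ]
    · simp [TernaryAlgebra.op, freeTernary_τ]
  · refine Prod.ext ?_ ?_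
    · funext j
      fin_cases j <;> simp [TernaryAlgebra.op, freeTernary_τ]
    · simp [TernaryAlgebra.op, freeTernary_τ]

/-- Conditions on a submodule `V` of `R³ × P` under which `q(F₃) / V` exists and is a
non-associative hamiltonian quasimodule. -/
theorem exists_hamiltonian_quotient {R : Type u} [CommRing R] {Φ : R →+* ZMod 3}
    (V : Submodule R (FreeTernaryCarrier Φ)) (hV : ∀ v ∈ V, ∀ j, v.1 j ∈ RingHom.ker Φ)
    (h1 : ((0, 1) : FreeTernaryCarrier Φ) ∉ V)
    (hess : ∀ x ∉ V, ∃ r : R, ((0, 1) : FreeTernaryCarrier Φ) - r • x ∈ V)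
    [Small.{v} (FreeTernaryCarrier Φ ⧸ V)] :
    ∃ (Q : Type v) (_ : CommMoufangLoop Q) (_ : SMul R Q), IsQuasimodule Φ Q ∧
      ¬ IsAssociativeLoop Q ∧ IsHamiltonianQuasimodule R Q ∧
      ∃ f : (freeTernary Φ).Quasi → Q, IsQuasimoduleHom R f ∧
        Function.Surjective f ∧ f ⁻¹' {0} = (V : Set (FreeTernaryCarrier Φ)) := by
  let f : FreeTernaryCarrier Φ →ₗ[R] Shrink.{v} (FreeTernaryCarrier Φ ⧸ V) :=
    (Shrink.linearEquiv R _).symm.toLinearMap ∘ₗ V.mkQ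
  have hf : Function.Surjective f :=
    (Shrink.linearEquiv R _).symm.surjective.comp V.mkQ_surjective
  have hker : ∀ x, f x = 0 ↔ x ∈ V := fun x =>
    ((Shrink.linearEquiv R _).symm.map_eq_zero_iff).trans (Submodule.Quotient.mk_eq_zero V)
  let T := (freeTernary Φ).push f hf
    (fun v hv => freeTernary_τ_left_eq_zero (hV v ((hker v).1 hv)))
    (fun v hv => freeTernary_τ_right_eq_zero (hV v ((hker v).1 hv)))
  have hop : ∀ x y, f ((freeTernary Φ).op x y) = T.1.op (f x) (f y) := fun x y => by
    rw [TernaryAlgebra.op, TernaryAlgebra.op, map_add, map_add, ← map_sub, T.2]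
  refine ⟨T.1.Quasi, inferInstance, inferInstance, inferInstance, ?_, ?_, f, ⟨hop, ?_⟩, hf, ?_⟩
  · intro hassoc
    have h := map_eq_of_isAssociativeLoop (B := T.1.Quasi) (f := f) hassoc hop
    have h' : f (![1, 1, 1], 0) - f (![1, 1, 1], -1) = 0 := sub_eq_zero.2 h
    rw [← map_sub, hker, Prod.mk_sub_mk, sub_self, zero_sub, neg_neg] at h'
    exact h1 h'
  · refine T.1.isHamiltonianQuasimodule (e := f (0, 1)) ?_ ?_
    · intro N hN
      obtain ⟨x, hx, hx0⟩ := Submodule.exists_mem_ne_zero_of_ne_bot hN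
      obtain ⟨x, rfl⟩ := hf x
      obtain ⟨r, hr⟩ := hess x fun h => hx0 ((hker x).2 h)
      rw [← hker, map_sub, sub_eq_zero, map_smul] at hr
      rw [hr]
      exact N.smul_mem r hx
    · intro x y z
      obtain ⟨x, rfl⟩ := hf x
      obtain ⟨y, rfl⟩ := hf y
      obtain ⟨z, rfl⟩ := hf z
      rw [T.2, freeTernary_τ, ← Set.image_singleton, ← Submodule.map_span]
      exact ⟨_, mk_mem_span_inr_one _, rfl⟩
  · exact fun r x => f.map_smul r x
  · ext x
    exact hker x

theorem exists_hamiltonian_quotient_graphSet {R : Type u} [CommRing R] {Φ : R →+* ZMod 3}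
    {M : Type w} [AddCommGroup M] [Module R M] [Finite M] (hM : IsPrimitiveTorsion Φ M) {s : M}
    (hs0 : s ≠ 0)
    (hs : ∀ N : Submodule R M, N ≠ ⊥ → s ∈ N) {π : (Fin 3 → R) →ₗ[R] M}
    (hπ : (LinearMap.range π).spanFinrank = 3) {A : Submodule R (Fin 3 → R)}
    {φ : A →ₗ[R] R ⧸ RingHom.ker Φ} (hφ : Function.Surjective φ)
    (hker : (LinearMap.ker φ).map A.subtype = LinearMap.ker π) :
    ∃ (Q : Type v) (_ : CommMoufangLoop Q) (_ : SMul R Q), IsQuasimodule Φ Q ∧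
      ¬ IsAssociativeLoop Q ∧ IsHamiltonianQuasimodule R Q ∧
      ∃ f : (freeTernary Φ).Quasi → Q, IsQuasimoduleHom R f ∧
        Function.Surjective f ∧ f ⁻¹' {0} = graphSet Φ A φ := by
  have hφπ : ∀ y (hy : y ∈ A), φ ⟨y, hy⟩ = 0 ↔ π y = 0 := by
    intro y hy
    rw [← LinearMap.mem_ker, ← LinearMap.mem_ker, ← hker]
    constructor
    · exact fun h => ⟨_, h, rfl⟩
    · rintro ⟨z, hz, rfl⟩
      exact hz
  have hkerA : ∀ y, π y = 0 → y ∈ A := by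
    intro y hy
    rw [← LinearMap.mem_ker, ← hker] at hy
    obtain ⟨z, -, rfl⟩ := hy
    exact z.2
  have hIP : ∀ i ∈ RingHom.ker Φ, ∀ t : R ⧸ RingHom.ker Φ, i • t = 0 := by
    intro i hi t
    rw [Algebra.smul_def, Ideal.Quotient.algebraMap_eq, Ideal.Quotient.eq_zero_iff_mem.2 hi,
      zero_mul]
  -- For any admissible pair, `π(A)` lies in the socle: if `s = r π(y)` with `r ∈ I`, then `φ(r y) =
  -- r φ(y) = 0` would force `s = 0`, so `r` acts invertibly and `π(y)` is a multiple of `s`.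
  have hmul : ∀ y (_ : y ∈ A) (x : M), x ≠ 0 → π y ∈ Submodule.span R {x} := by
    intro y hy x hx
    by_cases hy0 : π y = 0
    · rw [hy0]
      exact zero_mem _
    obtain ⟨r, hr⟩ := Submodule.mem_span_singleton.1
      (hs (Submodule.span R {π y}) (by simpa using hy0))
    have hrI : r ∉ RingHom.ker Φ := by
      intro hrI
      have := (hφπ (r • y) (A.smul_mem r hy)).1 (by
        rw [← hIP r hrI (φ ⟨y, hy⟩), ← map_smul]
        rfl)
      rw [map_smul, hr] at this
      exact hs0 this
    obtain ⟨t, ht⟩ := hM.exists_smul_smul_eq hrI (π y)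
    rw [← ht, hr]
    exact Submodule.smul_mem _ _ (hs _ (by simpa using hx))
  let V : Submodule R (FreeTernaryCarrier Φ) :=
    { carrier := {x | ∃ h : x.1 ∈ A, φ ⟨x.1, h⟩ = x.2}
      zero_mem' := ⟨A.zero_mem, map_zero φ⟩
      add_mem' := by
        rintro x y ⟨hx, hx'⟩ ⟨hy, hy'⟩
        refine ⟨A.add_mem hx hy, ?_⟩
        rw [Prod.snd_add, ← hx', ← hy', ← map_add]
        rfl
      smul_mem' := by
        rintro r x ⟨hx, hx'⟩
        refine ⟨A.smul_mem r hx, ?_⟩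
        rw [Prod.smul_snd, ← hx', ← map_smul]
        rfl }
  have hV : ∀ v ∈ V, ∀ j, v.1 j ∈ RingHom.ker Φ := by
    rintro v ⟨hv, -⟩ j
    exact apply_mem_ker_of_map_mem_span hM hs hπ (hmul _ hv s hs0) j
  have : Nontrivial (R ⧸ RingHom.ker Φ) :=
    Ideal.Quotient.nontrivial_iff.2 (RingHom.ker_ne_top Φ)
  have h1 : ((0, 1) : FreeTernaryCarrier Φ) ∉ V := by
    rintro ⟨h, h'⟩
    exact zero_ne_one ((map_zero φ).symm.trans h')
  have hinl : ∀ x : FreeTernaryCarrier Φ, ∃ y : Fin 3 → R, x - (y, 0) ∈ V := by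
    rintro ⟨y, t⟩
    obtain ⟨⟨z, hz⟩, rfl⟩ := hφ t
    refine ⟨y - z, ?_⟩
    rw [Prod.mk_sub_mk, sub_sub_cancel, sub_zero]
    exact ⟨hz, rfl⟩
  have hkerV : ∀ y, π y = 0 → ((y, 0) : FreeTernaryCarrier Φ) ∈ V := fun y hy =>
    ⟨hkerA y hy, (hφπ y _).2 hy⟩
  have hess : ∀ x ∉ V, ∃ r : R, ((0, 1) : FreeTernaryCarrier Φ) - r • x ∈ V := by
    intro x hx
    obtain ⟨y, hy⟩ := hinl x
    obtain ⟨⟨z, hz⟩, hz1⟩ := hφ 1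
    have hy0 : π y ≠ 0 := fun h => hx (by
      rw [← sub_add_cancel x (y, 0)]
      exact V.add_mem hy (hkerV y h))
    obtain ⟨r, hr⟩ := Submodule.mem_span_singleton.1 (hmul z hz _ hy0)
    -- The sign arises because `(z, 1) ∈ V` makes `a₄` congruent to `-(z, 0)`, while `π z = r π y`.
    refine ⟨-r, ?_⟩
    have h2 : ((z, 1) : FreeTernaryCarrier Φ) ∈ V := ⟨hz, hz1⟩
    have h3 := hkerV (r • y - z) (by rw [map_sub, map_smul, hr, sub_self])
    have h4 := V.add_mem (V.add_mem (V.smul_mem r hy) h2) h3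
    convert h4 using 1
    refine Prod.ext ?_ ?_
    · simp [smul_sub]
    · simp [add_comm]
  have hfin : Finite (FreeTernaryCarrier Φ ⧸ V) := by
    have : Finite ((Fin 3 → R) ⧸ LinearMap.ker π) :=
      Finite.of_equiv _ π.quotKerEquivRange.symm.toEquiv
    let g : ((Fin 3 → R) ⧸ LinearMap.ker π) →ₗ[R] FreeTernaryCarrier Φ ⧸ V :=
      (LinearMap.ker π).liftQ (V.mkQ ∘ₗ LinearMap.inl R _ _) fun y hy => by
        simpa using hkerV y hy
    refine Finite.of_surjective g fun x => ?_
    obtain ⟨x, rfl⟩ := V.mkQ_surjective x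
    obtain ⟨y, hy⟩ := hinl x
    exact ⟨Submodule.Quotient.mk y, ((Submodule.Quotient.eq V).2 hy).symm⟩
  exact exists_hamiltonian_quotient V hV h1 hess

end Free

/-! ### Finiteness by Artin–Rees -/

section Finiteness

variable {R : Type*} [CommRing R] {M : Type*} [AddCommGroup M] [Module R M]

/-- By Artin–Rees, `Iᵏ⁺¹ M ∩ R s = I (Iᵏ M ∩ R s)` for some `k`, which is 0 since `I s = 0`; as `s`
lies in every non-zero submodule, `Iᵏ⁺¹ M = 0`. -/
theorem exists_pow_smul_eq_zero_of_essential [IsNoetherianRing R] [Module.Finite R M] {I : Ideal R}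
    {s : M} (hs0 : s ≠ 0) (hs : ∀ N : Submodule R M, N ≠ ⊥ → s ∈ N) (hI : ∀ i ∈ I, i • s = 0) :
    ∃ n : ℕ, ∀ r ∈ I ^ n, ∀ x : M, r • x = 0 := by
  obtain ⟨k, hk⟩ := I.exists_pow_inf_eq_pow_smul (Submodule.span R {s})
  have h1 := hk (k + 1) (Nat.le_succ k)
  rw [Nat.add_sub_cancel_left, pow_one] at h1
  have h2 : I • (I ^ k • ⊤ ⊓ Submodule.span R {s}) = ⊥ := by
    refine eq_bot_iff.2 (Submodule.smul_le.2 fun i hi x hx => ?_)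
    obtain ⟨r, rfl⟩ := Submodule.mem_span_singleton.1 hx.2
    rw [smul_comm, hI i hi, smul_zero]
    exact zero_mem _
  rw [h2] at h1
  have h3 : I ^ (k + 1) • (⊤ : Submodule R M) = ⊥ := by
    by_contra h
    have hmem : s ∈ I ^ (k + 1) • (⊤ : Submodule R M) ⊓ Submodule.span R {s} :=
      ⟨hs _ h, Submodule.mem_span_singleton_self s⟩
    rw [h1, Submodule.mem_bot] at hmem
    exact hs0 hmem
  refine ⟨k + 1, fun r hr x => ?_⟩
  have := Submodule.smul_mem_smul hr (Submodule.mem_top (x := x))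
  rwa [h3, Submodule.mem_bot] at this

theorem finite_of_pow_smul_eq_zero [IsNoetherianRing R] [Module.Finite R M] {I : Ideal R}
    [Finite (R ⧸ I)] {n : ℕ} (h : ∀ r ∈ I ^ n, ∀ x : M, r • x = 0) : Finite M := by
  have := Ideal.finite_quotient_pow (IsNoetherian.noetherian I) n
  have hM : Module.IsTorsionBySet R M (I ^ n : Ideal R) := fun x r => h r.1 r.2 x
  let _ := hM.module
  have : IsScalarTower R (R ⧸ I ^ n) M := hM.isScalarTower
  have : Module.Finite (R ⧸ I ^ n) M := Module.Finite.of_restrictScalars_finite R _ _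
  exact Module.finite_of_finite (R ⧸ I ^ n)

end Finiteness

/-! ### From hamiltonian quasimodules to cocyclic modules -/

section Free

variable {R : Type*} [CommRing R] {Φ : R →+* ZMod 3}

theorem freeTernary_op_eq_add {x : FreeTernaryCarrier Φ} (hx : ∀ j, x.1 j ∈ RingHom.ker Φ)
    (y : FreeTernaryCarrier Φ) : (freeTernary Φ).op x y = x + y := by
  rw [TernaryAlgebra.op, freeTernary_τ_left_eq_zero hx, add_zero]

/-- Each coordinate of an element of `R³` is, up to sign, an associator in `q(F₃)`. -/
theorem exists_freeTernary_associator (n : FreeTernaryCarrier Φ) (j : Fin 3) :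
    ∃ (x y : FreeTernaryCarrier Φ) (d : R), (d = n.1 j ∨ d = -n.1 j) ∧
      (freeTernary Φ).op ((freeTernary Φ).op n ((freeTernary Φ).op x y))
        (0, Submodule.Quotient.mk d) = (freeTernary Φ).op ((freeTernary Φ).op n x) y := by
  obtain ⟨a, t⟩ := n
  fin_cases j
  · refine ⟨(Pi.single 1 1, 0), (Pi.single 2 1, 0), a 0, Or.inl rfl, Prod.ext ?_ ?_⟩
    · funext j
      fin_cases j <;> simp [TernaryAlgebra.op, freeTernary_τ]
    · simp [TernaryAlgebra.op, freeTernary_τ]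
      ring
  · refine ⟨(Pi.single 0 1, 0), (Pi.single 2 1, 0), -a 1, Or.inr rfl, Prod.ext ?_ ?_⟩
    · funext j
      fin_cases j <;> simp [TernaryAlgebra.op, freeTernary_τ]
    · simp [TernaryAlgebra.op, freeTernary_τ]
      ring
  · refine ⟨(Pi.single 0 1, 0), (Pi.single 1 1, 0), a 2, Or.inl rfl, Prod.ext ?_ ?_⟩
    · funext j
      fin_cases j <;> simp [TernaryAlgebra.op, freeTernary_τ]
    · simp [TernaryAlgebra.op, freeTernary_τ]
      ring

/-- If `q(F₃)` maps to a hamiltonian quasimodule, then a subquasimodule which contains the kernel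
but not `a₄` lies in `I R³ × P`. -/
theorem Subquasimodule.apply_mem_ker_of_hamiltonian {Q : Type*} [CommMoufangLoop Q] [SMul R Q]
    [IsQuasimodule Φ Q] (hQ : IsHamiltonianQuasimodule R Q) {g : (freeTernary Φ).Quasi → Q}
    (hg : IsQuasimoduleHom R g) (N : Subquasimodule R (freeTernary Φ).Quasi)
    (hgN : ∀ v, g v = 0 → v ∈ N.carrier)
    (h1 : ((0, 1) : FreeTernaryCarrier Φ) ∉ N.carrier)
    {n : FreeTernaryCarrier Φ} (hn : n ∈ N.carrier) (j : Fin 3) : n.1 j ∈ RingHom.ker Φ := by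
  let P : Subquasimodule R Q :=
    { carrier := g '' N.carrier
      zero_mem := ⟨0, N.zero_mem, by
        have h := hg.map_smul 0 0
        rwa [IsQuasimodule.zero_smul Φ, IsQuasimodule.zero_smul Φ] at h⟩
      add_mem := by
        rintro _ _ ⟨x, hx, rfl⟩ ⟨y, hy, rfl⟩
        exact ⟨_, N.add_mem hx hy, hg.map_add x y⟩
      smul_mem := by
        rintro r _ ⟨x, hx, rfl⟩
        exact ⟨_, N.smul_mem r hx, hg.map_smul r x⟩ }
  obtain ⟨x, y, d, hd, hass⟩ := exists_freeTernary_associator n j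
  let x' : (freeTernary Φ).Quasi := x
  let y' : (freeTernary Φ).Quasi := y
  let n' : (freeTernary Φ).Quasi := n
  let a : (freeTernary Φ).Quasi := ((0, Submodule.Quotient.mk d) : FreeTernaryCarrier Φ)
  have hass' : (n' + (x' + y')) + a = (n' + x') + y' := hass
  have hga : g a ∈ P.carrier := by
    refine CommMoufangLoop.associator_mem_of_isNormal Φ (x := g n') (y := g x') (z := g y') (hQ P)
      (Or.inl ⟨n', hn, rfl⟩) ?_
    rw [← hg.map_add, ← hg.map_add, ← hg.map_add, ← hg.map_add, hass', hg.map_add, hg.map_add]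
  obtain ⟨m, hm, hma⟩ := hga
  have haN : a ∈ N.carrier := by
    -- `a` and `m` have the same image, so `-m + a` lies in the kernel and hence in `N`.
    refine N.mem_of_add_mem Φ (N.smul_mem (-1) hm) (hgN _ ?_)
    rw [hg.map_add, hg.map_smul, hma, CommMoufangLoop.neg_smul_add_self Φ]
  have hdI : d ∈ RingHom.ker Φ := by
    by_contra hdI
    refine h1 ?_
    have h2 := N.smul_mem d haN
    have h3 : d • a = ((0, 1) : FreeTernaryCarrier Φ) := by
      refine Prod.ext (smul_zero d) ?_
      refine (Submodule.Quotient.eq (RingHom.ker Φ)).2 ?_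
      change d * d - 1 ∈ RingHom.ker Φ
      rw [← neg_sub, ← sq]
      exact Ideal.neg_mem_iff _ |>.2 (one_sub_sq_mem_ker hdI)
    rwa [h3] at h2
  rcases hd with hd | hd
  · rwa [← hd]
  · rw [hd] at hdI
    exact (Ideal.neg_mem_iff _).1 hdI

theorem exists_submodule_of_hamiltonian [IsNoetherianRing R] {Q : Type*} [CommMoufangLoop Q]
    [SMul R Q] [IsQuasimodule Φ Q] (hna : ¬ IsAssociativeLoop Q)
    (hQ : IsHamiltonianQuasimodule R Q) :
    ∃ W : Submodule R (FreeTernaryCarrier Φ), (∀ x ∈ W, ∀ j, x.1 j ∈ RingHom.ker Φ) ∧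
      ((0, 1) : FreeTernaryCarrier Φ) ∉ W ∧
      ∀ x ∉ W, ((0, 1) : FreeTernaryCarrier Φ) ∈ W ⊔ Submodule.span R {x} := by
  obtain ⟨A, hA⟩ := CommMoufangLoop.exists_isCentralAssociator Φ hQ
  have hne : ∃ x y z : Q, (A x y z : Q) ≠ 0 := by
    by_contra! h
    exact hna fun x y z => by rw [hA x y z, h, zero_add]
  obtain ⟨x₁, x₂, x₃, hc⟩ := hne
  obtain ⟨g, hg, hg1⟩ := hA.exists_hom_freeTernary (Φ := Φ) x₁ x₂ x₃
  have key := Subquasimodule.apply_mem_ker_of_hamiltonian hQ hg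
  have hg0 : g (0 : FreeTernaryCarrier Φ) = 0 := by
    have h := hg.map_smul 0 0
    rwa [IsQuasimodule.zero_smul Φ, IsQuasimodule.zero_smul Φ] at h
  have hg_add : ∀ x y : FreeTernaryCarrier Φ, g ((freeTernary Φ).op x y) = g x + g y := hg.map_add
  have hg_smul : ∀ (r : R) (x : FreeTernaryCarrier Φ), g (r • x : FreeTernaryCarrier Φ) = r • g x :=
    hg.map_smul
  let K : Subquasimodule R (freeTernary Φ).Quasi :=
    { carrier := {x | g x = 0}
      zero_mem := hg0
      add_mem := fun {x y} (hx : g x = 0) (hy : g y = 0) => by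
        change g (x + y) = 0
        rw [hg.map_add, hx, hy, add_zero]
      smul_mem := fun r x (hx : g x = 0) => by
        change g (r • x) = 0
        rw [hg.map_smul, hx, CommMoufangLoop.smul_zero' Φ] }
  have hKI : ∀ x : FreeTernaryCarrier Φ, g x = 0 → ∀ j, x.1 j ∈ RingHom.ker Φ := fun x hx =>
    key K (fun _ h => h) (fun h => hc (hg1.symm.trans h)) hx
  let 𝒲 : Set (Submodule R (FreeTernaryCarrier Φ)) :=
    {W | (∀ x, g x = 0 → x ∈ W) ∧ (∀ x ∈ W, ∀ j, x.1 j ∈ RingHom.ker Φ) ∧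
      ((0, 1) : FreeTernaryCarrier Φ) ∉ W}
  let V : Submodule R (FreeTernaryCarrier Φ) :=
    { carrier := {x | g x = 0}
      zero_mem' := hg0
      add_mem' := fun {x y} (hx : g x = 0) (hy : g y = 0) => by
        change g (x + y : FreeTernaryCarrier Φ) = 0
        rw [← freeTernary_op_eq_add (hKI x hx), hg_add, hx, hy, add_zero]
      smul_mem' := fun r x (hx : g x = 0) => by
        change g (r • x : FreeTernaryCarrier Φ) = 0
        rw [hg_smul, hx, CommMoufangLoop.smul_zero' Φ] }
  obtain ⟨W, ⟨hW1, hW2, hW3⟩, hmax⟩ := set_has_maximal_iff_noetherian.2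
    (inferInstance : IsNoetherian R (FreeTernaryCarrier Φ)) 𝒲
    ⟨V, fun _ h => h, hKI, fun h => hc (hg1.symm.trans h)⟩
  refine ⟨W, hW2, hW3, fun x hxW => ?_⟩
  by_contra h1
  let U : Submodule R (FreeTernaryCarrier Φ) := W ⊔ Submodule.span R {x}
  have hWU : W ≤ U := le_sup_left
  -- `τ` ignores the components in `W` and vanishes on two multiples of the same `x`, so the loop
  -- operation on `U` is addition and `U` is a subquasimodule. If it missed `a₄`, it would lie in `I
  -- R³ × P`, against maximality.
  have hU : ∀ a b : FreeTernaryCarrier Φ, a ∈ U → b ∈ U → (freeTernary Φ).op a b ∈ U := by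
    intro a b ha hb
    suffices h : (freeTernary Φ).op a b = a + b by
      rw [h]
      exact add_mem ha hb
    obtain ⟨w, hw, _, hr, rfl⟩ := Submodule.mem_sup.1 ha
    obtain ⟨w', hw', _, hr', rfl⟩ := Submodule.mem_sup.1 hb
    obtain ⟨r, rfl⟩ := Submodule.mem_span_singleton.1 hr
    obtain ⟨r', rfl⟩ := Submodule.mem_span_singleton.1 hr'
    rw [TernaryAlgebra.op, add_eq_left, map_add (freeTernary Φ).τ, LinearMap.add_apply,
      LinearMap.add_apply,
      freeTernary_τ_left_eq_zero (hW2 w hw), map_add ((freeTernary Φ).τ _), LinearMap.add_apply,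
      (freeTernary Φ).τ_swap w', freeTernary_τ_left_eq_zero (hW2 w' hw')]
    simp only [map_smul, LinearMap.smul_apply, (freeTernary Φ).τ_self, smul_zero, neg_zero,
      add_zero]
  let N : Subquasimodule R (freeTernary Φ).Quasi :=
    { carrier := {y : FreeTernaryCarrier Φ | y ∈ U}
      zero_mem := U.zero_mem
      add_mem := fun {a b} => hU a b
      smul_mem := fun r _ => U.smul_mem r }
  refine hmax U ⟨fun y hy => hWU (hW1 y hy), ?_, h1⟩ ?_
  · exact fun y hy => key N (fun y hy => hWU (hW1 y hy)) h1 hy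
  · refine lt_of_le_of_ne hWU fun h => hxW ?_
    rw [h]
    exact Submodule.mem_sup_right (Submodule.mem_span_singleton_self x)

theorem finite_quotient_ker_zmod (Φ : R →+* ZMod 3) : Finite (R ⧸ RingHom.ker Φ) :=
  Finite.of_injective _ (RingHom.kerLift_injective Φ)

/-- Reduction of the `R³` coordinates by `Φ` kills `W`, giving a semilinear surjection onto a
three-dimensional space over `ℤ/3`; generators map to generators. -/
theorem three_le_spanFinrank (hΦ : Function.Surjective Φ) {M : Type*} [AddCommGroup M]
    [Module R M] [Module.Finite R M] {W : Submodule R (FreeTernaryCarrier Φ)}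
    (hW : ∀ x ∈ W, ∀ j, x.1 j ∈ RingHom.ker Φ) (e : M ≃ₗ[R] FreeTernaryCarrier Φ ⧸ W) :
    3 ≤ (⊤ : Submodule R M).spanFinrank := by
  have : RingHomSurjective Φ := ⟨hΦ⟩
  let h : FreeTernaryCarrier Φ →ₛₗ[Φ] (Fin 3 → ZMod 3) :=
    { toFun := fun x j => Φ (x.1 j)
      map_add' := fun x y => funext fun j => map_add Φ _ _
      map_smul' := fun r x => funext fun j => map_mul Φ _ _ }
  have hker : W ≤ LinearMap.ker h := fun x hx => funext (hW x hx)
  let k : M →ₛₗ[Φ] (Fin 3 → ZMod 3) := (W.liftQ h hker).comp e.toLinearMap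
  have hk : Function.Surjective k := by
    intro t
    choose y hy using fun j => hΦ (t j)
    exact ⟨e.symm (Submodule.Quotient.mk (y, 0)), by
      simp only [k, LinearMap.comp_apply, LinearEquiv.coe_coe, LinearEquiv.apply_symm_apply]
      exact funext hy⟩
  have h1 := Submodule.spanFinrank_map_le_of_fg k (Module.Finite.fg_top (R := R) (M := M))
  rw [Submodule.map_top, LinearMap.range_eq_top.2 hk] at h1
  have : Fact (Nat.Prime 3) := ⟨Nat.prime_three⟩
  rwa [← Module.finrank_eq_spanFinrank_of_free, Module.finrank_fin_fun] at h1

theorem exists_finite_cocyclic_module {R : Type u} [CommRing R] [IsNoetherianRing R]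
    {Φ : R →+* ZMod 3} (hΦ : Function.Surjective Φ) {Q : Type v} [CommMoufangLoop Q]
    [SMul R Q] [IsQuasimodule Φ Q] (hna : ¬ IsAssociativeLoop Q)
    (hQ : IsHamiltonianQuasimodule R Q) :
    ∃ (M : Type w) (_ : AddCommGroup M) (_ : Module R M), Finite M ∧
      IsCocyclicModule R M ∧ IsPrimitiveTorsion Φ M ∧
      3 ≤ (⊤ : Submodule R M).spanFinrank := by
  obtain ⟨W, hW, h1, hess⟩ := exists_submodule_of_hamiltonian (Φ := Φ) hna hQ
  let s : FreeTernaryCarrier Φ ⧸ W := Submodule.Quotient.mk (0, 1)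
  have hs0 : s ≠ 0 := fun h => h1 ((Submodule.Quotient.mk_eq_zero W).1 h)
  have hs : ∀ N : Submodule R (FreeTernaryCarrier Φ ⧸ W), N ≠ ⊥ → s ∈ N := by
    intro N hN
    obtain ⟨x, hx, hx0⟩ := Submodule.exists_mem_ne_zero_of_ne_bot hN
    obtain ⟨x, rfl⟩ := W.mkQ_surjective x
    obtain ⟨w, hw, _, hr, hwr⟩ := Submodule.mem_sup.1
      (hess x fun h => hx0 ((Submodule.Quotient.mk_eq_zero W).2 h))
    obtain ⟨r, rfl⟩ := Submodule.mem_span_singleton.1 hr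
    have : s = r • W.mkQ x := by
      rw [← map_smul]
      refine (Submodule.Quotient.eq W).2 ?_
      rwa [← hwr, add_sub_cancel_right]
    rw [this]
    exact N.smul_mem r hx
  have hIs : ∀ i ∈ RingHom.ker Φ, i • s = 0 := by
    intro i hi
    have : (i • (0, 1) : FreeTernaryCarrier Φ) = 0 := by
      refine Prod.ext (smul_zero i) ((Submodule.Quotient.mk_eq_zero (RingHom.ker Φ)).2 ?_)
      exact Ideal.mul_mem_right _ _ hi
    rw [← Submodule.Quotient.mk_smul, this, Submodule.Quotient.mk_zero]
  obtain ⟨n, hn⟩ := exists_pow_smul_eq_zero_of_essential hs0 hs hIs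
  have := finite_quotient_ker_zmod Φ
  have hfin : Finite (FreeTernaryCarrier Φ ⧸ W) := finite_of_pow_smul_eq_zero hn
  -- Finiteness allows the quotient to be moved to an arbitrary universe.
  let e : Shrink.{w} (FreeTernaryCarrier Φ ⧸ W) ≃ₗ[R] FreeTernaryCarrier Φ ⧸ W :=
    Shrink.linearEquiv R _
  have : Module.Finite R (Shrink.{w} (FreeTernaryCarrier Φ ⧸ W)) := Module.Finite.equiv e.symm
  refine ⟨Shrink.{w} (FreeTernaryCarrier Φ ⧸ W), inferInstance, inferInstance,
    Finite.of_equiv _ e.symm.toEquiv, isCocyclicModule_iff.2 ⟨e.symm s, ?_, fun N hN => ?_⟩,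
    isPrimitiveTorsion_of_pow_smul (n := n) fun r hr x => ?_, three_le_spanFinrank hΦ hW e⟩
  · exact fun h => hs0 ((LinearEquiv.map_eq_zero_iff _).1 h)
  · have := hs (N.comap e.symm.toLinearMap) fun h => hN ?_
    · exact this
    · rw [← Submodule.map_comap_eq_of_surjective (f := e.symm.toLinearMap) e.symm.surjective N, h,
        Submodule.map_bot]
  · rw [← e.map_eq_zero_iff, map_smul, hn r hr]

end Free

theorem mainTheorem3 {R : Type u} [CommRing R] [IsNoetherianRing R]
    (Φ : R →+* ZMod 3) (hΦ : Function.Surjective Φ) :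
    ((∃ (Q : Type v) (_ : CommMoufangLoop Q) (_ : SMul R Q), IsQuasimodule Φ Q ∧
        ¬ IsAssociativeLoop Q ∧ IsHamiltonianQuasimodule R Q) ↔
      ∃ (M : Type w) (_ : AddCommGroup M) (_ : Module R M), Finite M ∧
        IsCocyclicModule R M ∧ IsPrimitiveTorsion Φ M ∧
        3 ≤ (⊤ : Submodule R M).spanFinrank) ∧
    ∀ (M : Type w) [AddCommGroup M] [Module R M], Finite M →
      IsCocyclicModule R M → IsPrimitiveTorsion Φ M →
      3 ≤ (⊤ : Submodule R M).spanFinrank →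
      (∃ π : (Fin 3 → R) →ₗ[R] M, (LinearMap.range π).spanFinrank = 3) ∧
      ∀ π : (Fin 3 → R) →ₗ[R] M, (LinearMap.range π).spanFinrank = 3 →
        (∃ (A : Submodule R (Fin 3 → R)) (φ : A →ₗ[R] R ⧸ RingHom.ker Φ),
          Function.Surjective φ ∧ (LinearMap.ker φ).map A.subtype = LinearMap.ker π) ∧
        ∀ (A : Submodule R (Fin 3 → R)) (φ : A →ₗ[R] R ⧸ RingHom.ker Φ),
          Function.Surjective φ → (LinearMap.ker φ).map A.subtype = LinearMap.ker π →
          ∃ (Q : Type v) (_ : CommMoufangLoop Q) (_ : SMul R Q), IsQuasimodule Φ Q ∧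
            ¬ IsAssociativeLoop Q ∧ IsHamiltonianQuasimodule R Q ∧
            ∃ f : (freeTernary Φ).Quasi → Q, IsQuasimoduleHom R f ∧
              Function.Surjective f ∧ f ⁻¹' {0} = graphSet Φ A φ := by
  have hne_bot : ∀ {M : Type w} [AddCommGroup M] [Module R M] {π : (Fin 3 → R) →ₗ[R] M},
      (LinearMap.range π).spanFinrank = 3 → LinearMap.range π ≠ ⊥ := by
    intro M _ _ π hπ h
    rw [h, Submodule.spanFinrank_bot] at hπ
    omega
  refine ⟨⟨?_, ?_⟩, ?_⟩
  · rintro ⟨Q, _, _, _, hna, hQ⟩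
    exact exists_finite_cocyclic_module hΦ hna hQ
  · rintro ⟨M, _, _, hfin, hcoc, htor, h3⟩
    obtain ⟨s, hs0, hs⟩ := isCocyclicModule_iff.1 hcoc
    obtain ⟨π, hπ⟩ := exists_linearMap_spanFinrank_range_eq_three (Module.Finite.fg_top) h3
    obtain ⟨A, φ, hφ, hker⟩ := exists_submodule_linearMap_quotient htor hs0 hs (hne_bot hπ)
    obtain ⟨Q, i, j, hq, hna, hQ, -⟩ :=
      exists_hamiltonian_quotient_graphSet.{u, v, w} htor hs0 hs hπ hφ hker
    exact ⟨Q, i, j, hq, hna, hQ⟩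
  · intro M _ _ hfin hcoc htor h3
    obtain ⟨s, hs0, hs⟩ := isCocyclicModule_iff.1 hcoc
    refine ⟨exists_linearMap_spanFinrank_range_eq_three (Module.Finite.fg_top) h3,
      fun π hπ => ⟨exists_submodule_linearMap_quotient htor hs0 hs (hne_bot hπ), ?_⟩⟩
    exact fun A φ hφ hker => exists_hamiltonian_quotient_graphSet htor hs0 hs hπ hφ hker
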